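/- Let $V \in L^\infty(\mathbb{R})$ be a real-valued bounded potential, and set $V_\infty = \|V\|_\infty$. For a bounded open interval $\Lambda = (a,b)$, let $H_\Lambda = -\Delta_\Lambda + V$ be the Schrödinger operator on $L^2(\Lambda)$ with Dirichlet boundary condition, i.e. $H_\Lambda \psi = -\psi'' + V\psi$ on the domain $\{\psi \in H^2(\Lambda) : \psi(a) = \psi(b) = 0\}$; it is self-adjoint, so it has a spectral measure $B \mapsto \chi_B(H_\Lambda)$. Let $$\eta_\Lambda(B) = \frac{1}{|\Lambda|} \operatorname{tr} \chi_B(H_\Lambda), \qquad B \subset \mathbb{R} \text{ Borel},$$ be the corresponding finite volume density of states measure. Then, given $E_0 \in \mathbb{R}$, there exist finite positive constants $L_{V_\infty,E_0}$ and $C_{V_\infty,E_0}$, depending only on $V_\infty$ and $E_0$, such that for all $0 < \varepsilon \le \tfrac12$, all open intervals $\Lambda$ of length $L \ge L_{V_\infty,E_0} \log\frac1\varepsilon$, and all energies $E \le E_0$, $$\eta_\Lambda([E, E+\varepsilon]) \le \frac{C_{V_\infty,E_0}}{\log \frac1\varepsilon}.$$ -/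

import Mathlib

open MeasureTheory Set
open scoped ENNReal InnerProductSpace

/-! ### Spectral measures, spectral projections and traces in a Hilbert space -/

section Hilbert

variable {H : Type*} [NormedAddCommGroup H] [InnerProductSpace ℂ H] [CompleteSpace H]

/-- A projection-valued measure on the Borel sets of `ℝ` with values in the orthogonal projections
of the Hilbert space `H` (its values on non-measurable sets are irrelevant). -/
structure ProjectionValuedMeasure (H : Type*) [NormedAddCommGroup H] [InnerProductSpace ℂ H]
    [CompleteSpace H] where
  proj : Set ℝ → (H →L[ℂ] H)
  isStarProjection : ∀ B, MeasurableSet B → IsStarProjection (proj B)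
  proj_univ : proj univ = 1
  proj_inter : ∀ B C, MeasurableSet B → MeasurableSet C → proj (B ∩ C) = proj B * proj C
  hasSum_proj : ∀ B : ℕ → Set ℝ, (∀ n, MeasurableSet (B n)) →
    Pairwise (Function.onFun Disjoint B) → ∀ ψ : H, HasSum (fun n => proj (B n) ψ) (proj (⋃ n, B n) ψ)

namespace ProjectionValuedMeasure

variable (P : ProjectionValuedMeasure H)

theorem proj_empty : P.proj ∅ = 0 := by
  ext ψ
  have h := P.hasSum_proj (fun _ => ∅) (fun _ => MeasurableSet.empty)
    (fun _ _ _ => by simp [Function.onFun]) ψ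
  simpa using tendsto_nhds_unique h.summable.tendsto_atTop_zero tendsto_const_nhds |>.symm

theorem inner_proj {B : Set ℝ} (hB : MeasurableSet B) (ψ : H) :
    ⟪ψ, P.proj B ψ⟫_ℂ = ((‖P.proj B ψ‖ ^ 2 : ℝ) : ℂ) := by
  have h1 := (P.isStarProjection B hB).isIdempotentElem
  have h2 := (P.isStarProjection B hB).isSelfAdjoint
  have h3 : P.proj B ψ = P.proj B (P.proj B ψ) := by
    conv_lhs => rw [← h1.eq]
    rfl
  have h4 : ⟪ψ, P.proj B (P.proj B ψ)⟫_ℂ = ⟪P.proj B ψ, P.proj B ψ⟫_ℂ :=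
    ((ContinuousLinearMap.isSelfAdjoint_iff_isSymmetric.mp h2) ψ (P.proj B ψ)).symm
  rw [h3, h4, inner_self_eq_norm_sq_to_K, ← h3]
  norm_cast

/-- The scalar spectral measure `B ↦ ⟨ψ, P(B) ψ⟩ = ‖P(B) ψ‖²` of the vector `ψ`. -/
noncomputable def scalarMeasure (ψ : H) : Measure ℝ :=
  Measure.ofMeasurable (fun B _ => ENNReal.ofReal (‖P.proj B ψ‖ ^ 2))
    (by simp [P.proj_empty])
    (by
      intro B hB hd
      have h := (P.hasSum_proj B hB hd ψ).mapL (innerSL ℂ ψ)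
      simp only [innerSL_apply_apply, P.inner_proj (MeasurableSet.iUnion hB), P.inner_proj (hB _)]
        at h
      have h' : HasSum (fun n => ‖P.proj (B n) ψ‖ ^ 2) (‖P.proj (⋃ n, B n) ψ‖ ^ 2) := by
        exact_mod_cast h
      rw [← h'.tsum_eq, ENNReal.ofReal_tsum_of_nonneg (fun n => by positivity) h'.summable])

theorem scalarMeasure_apply (ψ : H) {B : Set ℝ} (hB : MeasurableSet B) :
    P.scalarMeasure ψ B = ENNReal.ofReal (‖P.proj B ψ‖ ^ 2) :=
  Measure.ofMeasurable_apply B hB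

end ProjectionValuedMeasure

/-- `P` is the spectral measure of the (unbounded) operator `A`, that is `A = ∫ t dP(t)`: the domain
of `A` is `{ψ | ∫ t² d⟨ψ, P(t) ψ⟩ < ∞}`, and `⟨ψ, A ψ⟩ = ∫ t d⟨ψ, P(t) ψ⟩` for `ψ` in that domain.
Then `P.proj B` is the spectral projection `χ_B(A)`. -/
structure IsSpectralMeasure (A : H →ₗ.[ℂ] H) (P : ProjectionValuedMeasure H) : Prop where
  mem_domain_iff : ∀ ψ : H,
    ψ ∈ A.domain ↔ ∫⁻ t, ENNReal.ofReal (t ^ 2) ∂(P.scalarMeasure ψ) < ∞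
  inner_apply : ∀ ψ : A.domain,
    ⟪(ψ : H), A ψ⟫_ℂ = ((∫ t, t ∂(P.scalarMeasure (ψ : H)) : ℝ) : ℂ)

/-- The trace `∑ ⟨e, T e⟩ ∈ [0, ∞]` of a nonnegative operator `T`, the sum running over an
orthonormal basis of `H` (for nonnegative `T` the sum does not depend on the basis). -/
noncomputable def traceNonneg (T : H →L[ℂ] H) : ℝ≥0∞ :=
  ∑' e : (exists_hilbertBasis ℂ H).choose, ENNReal.ofReal (RCLike.re ⟪(e : H), T (e : H)⟫_ℂ)

end Hilbert

/-! ### Schrödinger operators with Dirichlet boundary condition on an interval -/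

/-- The complex Hilbert space `L²(Λ)`, `Λ = ]a, b[`. -/
abbrev L2Interval (a b : ℝ) : Type := Lp ℂ 2 (volume.restrict (Ioo a b))

/-- `f` belongs to the domain of the Dirichlet Laplacian on `]a, b[` and `g = f''`: `f` has a
representative `u` on `[a, b]` that is continuously differentiable, vanishes at `a` and `b`, and
whose derivative `v` is absolutely continuous with derivative `g ∈ L²`. Equivalently
`f ∈ H²(]a, b[) ∩ H¹₀(]a, b[)` and `g = Δ f`. -/
def IsDirichletLaplacian (a b : ℝ) (f g : L2Interval a b) : Prop :=
  ∃ u v : ℝ → ℂ, f =ᵐ[volume.restrict (Ioo a b)] u ∧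
    (∀ x ∈ Icc a b, HasDerivWithinAt u (v x) (Icc a b) x) ∧
    (∀ x ∈ Icc a b, v x = v a + ∫ t in a..x, g t) ∧ u a = 0 ∧ u b = 0

theorem L2Interval.integrableOn {a b : ℝ} (g : L2Interval a b) : IntegrableOn g (Ioo a b) :=
  (Lp.memLp g).integrable (by norm_num)

theorem L2Interval.intervalIntegrable {a b : ℝ} (g : L2Interval a b) {x : ℝ}
    (hx : x ∈ Icc a b) : IntervalIntegrable g volume a x := by
  rw [intervalIntegrable_iff_integrableOn_Ioo_of_le hx.1]
  exact g.integrableOn.mono_set (Ioo_subset_Ioo_right hx.2)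

theorem L2Interval.integral_congr {a b : ℝ} {g : L2Interval a b} {h : ℝ → ℂ}
    (hgh : g =ᵐ[volume.restrict (Ioo a b)] h) {x : ℝ} (hx : x ∈ Icc a b) :
    ∫ t in a..x, g t = ∫ t in a..x, h t := by
  rw [intervalIntegral.integral_of_le hx.1, intervalIntegral.integral_of_le hx.1,
    integral_Ioc_eq_integral_Ioo, integral_Ioc_eq_integral_Ioo]
  exact integral_congr_ae (ae_restrict_of_ae_restrict_of_subset (Ioo_subset_Ioo_right hx.2) hgh)

/-- The graph of the Dirichlet Laplacian. -/
def dirichletLaplacianGraph (a b : ℝ) : Submodule ℂ (L2Interval a b × L2Interval a b) where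
  carrier := {p | IsDirichletLaplacian a b p.1 p.2}
  zero_mem' := by
    refine ⟨0, 0, Lp.coeFn_zero _ _ _, fun x _ => hasDerivWithinAt_const x _ 0, fun x hx => ?_,
      rfl, rfl⟩
    simp only [Prod.snd_zero]
    rw [L2Interval.integral_congr (Lp.coeFn_zero ℂ 2 _) hx]
    simp
  add_mem' := by
    rintro ⟨f, g⟩ ⟨f', g'⟩ ⟨u, v, h1, h2, h3, h4, h5⟩ ⟨u', v', h1', h2', h3', h4', h5'⟩
    refine ⟨u + u', v + v', (Lp.coeFn_add f f').trans (h1.add h1'),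
      fun x hx => (h2 x hx).add (h2' x hx), fun x hx => ?_, by simp [h4, h4'], by simp [h5, h5']⟩
    simp only [Prod.snd_add] at *
    rw [L2Interval.integral_congr (Lp.coeFn_add g g') hx, Pi.add_apply, Pi.add_apply, h3 x hx,
      h3' x hx]
    simp only [Pi.add_apply]
    rw [intervalIntegral.integral_add (g.intervalIntegrable hx) (g'.intervalIntegrable hx)]
    ring
  smul_mem' := by
    rintro c ⟨f, g⟩ ⟨u, v, h1, h2, h3, h4, h5⟩
    refine ⟨c • u, c • v, (Lp.coeFn_smul c f).trans (h1.const_smul c),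
      fun x hx => (h2 x hx).const_smul c, fun x hx => ?_, by simp [h4], by simp [h5]⟩
    simp only [Prod.smul_snd] at *
    rw [L2Interval.integral_congr (Lp.coeFn_smul c g) hx, Pi.smul_apply, Pi.smul_apply, h3 x hx]
    simp only [Pi.smul_apply]
    rw [intervalIntegral.integral_smul, smul_add]

/-- The Dirichlet Laplacian is single-valued. -/
theorem IsDirichletLaplacian.eq_zero {a b : ℝ} {f g : L2Interval a b}
    (h : IsDirichletLaplacian a b f g) (hf : f = 0) : g = 0 := by
  rcases le_or_gt b a with hab | hab
  · apply Lp.ext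
    have h0 : ae (volume.restrict (Ioo a b)) = ⊥ := by
      rw [Ioo_eq_empty (not_lt.mpr hab), Measure.restrict_empty, ae_zero]
    simp only [Filter.EventuallyEq, h0, Filter.eventually_bot]
  obtain ⟨u, v, h1, h2, h3, h4, h5⟩ := h
  subst hf
  have hu0 : ∀ x ∈ Icc a b, u x = 0 := by
    have hc : ContinuousOn u (Icc a b) := fun x hx => (h2 x hx).continuousWithinAt
    have hae : u =ᵐ[volume.restrict (Icc a b)] (fun _ => (0 : ℂ)) := by
      rw [Measure.restrict_congr_set Ioo_ae_eq_Icc.symm]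
      exact h1.symm.trans (Lp.coeFn_zero _ _ _)
    exact fun x hx => Measure.eqOn_Icc_of_ae_eq volume hab.ne hae hc continuousOn_const hx
  have hv0 : ∀ x ∈ Icc a b, v x = 0 := by
    intro x hx
    have hd := (hasDerivWithinAt_const x (Icc a b) (0 : ℂ)).congr hu0 (hu0 x hx)
    exact (uniqueDiffOn_Icc hab x hx).eq_deriv _ (h2 x hx) hd
  have hint : ∀ x ∈ Icc a b, ∫ t in a..x, g t = 0 := by
    intro x hx
    have := h3 x hx
    rw [hv0 x hx, hv0 a (left_mem_Icc.mpr hab.le), zero_add] at this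
    exact this.symm
  have hz : ∀ᵐ x ∂(volume.restrict (Ioo a b)), g x = 0 := by
    rw [ae_restrict_iff' measurableSet_Ioo]
    have hI := (g.intervalIntegrable (right_mem_Icc.mpr hab.le))
    filter_upwards [hI.ae_hasDerivAt_integral] with x hx hxm
    have hxm' : x ∈ uIcc a b := by
      rw [uIcc_of_le hab.le]; exact Ioo_subset_Icc_self hxm
    have hd := hx hxm' a left_mem_uIcc
    have hd0 : HasDerivAt (fun y => ∫ t in a..y, g t) 0 x := by
      refine (hasDerivAt_const x (0 : ℂ)).congr_of_eventuallyEq ?_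
      filter_upwards [Icc_mem_nhds hxm.1 hxm.2] with y hy
      exact hint y hy
    exact hd.unique hd0
  apply Lp.ext
  filter_upwards [hz, Lp.coeFn_zero ℂ 2 (volume.restrict (Ioo a b))] with x h1 h2
  rw [h1, h2]; rfl

/-- The Laplacian `Δ_Λ` on `L²(Λ)`, `Λ = ]a, b[`, with Dirichlet boundary condition. -/
noncomputable def dirichletLaplacian (a b : ℝ) : L2Interval a b →ₗ.[ℂ] L2Interval a b :=
  (dirichletLaplacianGraph a b).toLinearPMap

theorem mem_graph_dirichletLaplacian_iff {a b : ℝ} {f g : L2Interval a b} :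
    (f, g) ∈ (dirichletLaplacian a b).graph ↔ IsDirichletLaplacian a b f g := by
  rw [dirichletLaplacian, Submodule.toLinearPMap_graph_eq]
  · rfl
  · rintro ⟨f, g⟩ hp hf
    exact IsDirichletLaplacian.eq_zero hp hf

/-- The bounded operator of multiplication by (the restriction to `Λ = ]a, b[` of) the real-valued
potential `V ∈ L^∞(ℝ)` on `L²(Λ)`. -/
noncomputable def potentialOperator (V : Lp ℝ ∞ (volume : Measure ℝ)) (a b : ℝ) :
    L2Interval a b →ₗ[ℂ] L2Interval a b where
  toFun f := (((Lp.memLp V).restrict (Ioo a b)).toLp V • f : L2Interval a b)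
  map_add' f g := Lp.add_smul _ f g
  map_smul' c f := by
    apply Lp.ext
    filter_upwards [Lp.coeFn_lpSMul (r := 2) (((Lp.memLp V).restrict (Ioo a b)).toLp V) f,
      Lp.coeFn_lpSMul (r := 2) (((Lp.memLp V).restrict (Ioo a b)).toLp V) (c • f),
      Lp.coeFn_smul c f, Lp.coeFn_smul c
        (((Lp.memLp V).restrict (Ioo a b)).toLp V • f : L2Interval a b)] with x h1 h2 h3 h4
    rw [h2, Pi.smul_apply', h3, RingHom.id_apply, h4, Pi.smul_apply, Pi.smul_apply, h1,
      Pi.smul_apply', smul_comm]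

theorem coeFn_potentialOperator (V : Lp ℝ ∞ (volume : Measure ℝ)) (a b : ℝ)
    (f : L2Interval a b) :
    potentialOperator V a b f =ᵐ[volume.restrict (Ioo a b)] fun x => (V x : ℂ) * f x := by
  change ((((Lp.memLp V).restrict (Ioo a b)).toLp V • f : L2Interval a b) : ℝ → ℂ) =ᵐ[_] _
  filter_upwards [Lp.coeFn_lpSMul (r := 2) (((Lp.memLp V).restrict (Ioo a b)).toLp V) f,
    ((Lp.memLp V).restrict (Ioo a b)).coeFn_toLp] with x h1 h2
  rw [h1, Pi.smul_apply', h2, Complex.real_smul]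

/-- The Schrödinger operator `H_Λ = -Δ_Λ + V` on `L²(Λ)`, `Λ = ]a, b[`, with Dirichlet boundary
condition; its domain is that of `Δ_Λ`. -/
noncomputable def dirichletSchrodinger (V : Lp ℝ ∞ (volume : Measure ℝ)) (a b : ℝ) :
    L2Interval a b →ₗ.[ℂ] L2Interval a b :=
  potentialOperator V a b +ᵥ (-dirichletLaplacian a b)

/-- The finite volume density of states measure `η_Λ(B) = |Λ|⁻¹ tr χ_B(H_Λ)`, `Λ = ]a, b[`, where
`P` is the spectral measure of `H_Λ`. -/
noncomputable def densityOfStates {a b : ℝ} (P : ProjectionValuedMeasure (L2Interval a b))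
    (B : Set ℝ) : ℝ≥0∞ :=
  traceNonneg (P.proj B) / volume (Ioo a b)

/-!
The spectral projection `Q` of `H = -Δ + V` on the energy interval `[E, E + ε]` has small rank because
its range consists of approximate solutions of a second order ordinary differential equation.
A vector `ψ` in the range satisfies `‖(H - E) ψ‖ ≤ ε ‖ψ‖` (`IsSpectralMeasure.norm_sub_smul_le`). Cut
the interval into `n` cells of length `δ`. If `ψ` and `ψ'` vanish at the left end of every cell, then
Gronwall's inequality in each cell gives `‖ψ‖ ≤ δ exp (K δ) ‖(H - E) ψ‖`, where `K ≥ 1` bounds `|V - E|`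
(`norm_le_of_cauchyData_eq_zero`). With `δ` a small multiple of `log (1 / ε)` the factor
`δ exp (K δ)` is less than `1 / ε`, so that `ψ = 0`. These are `2n` linear conditions on `ψ`, and hence the rank of `Q` is at most `2n`
(`traceNonneg_proj_Icc_le`), which is of order `(b - a) / log (1 / ε)`. The constant `K` is uniform in
`E ≤ E₀`, because `Q = 0` when `E + ε < -‖V‖` (`proj_Icc_eq_zero_of_lt`).

The spectral measure enters only through its defining properties, the domain and the quadratic form of
`H`. Polarization of the form shows that `H` maps the range of `Q` to itself, which leads to the bound
on `(H - E) ψ`.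

For the existence of the spectral measure, write `-Δ = (T†T)⁻¹`, where `T g` is the function
`∫_x^b g` with its mean subtracted (`isDirichletLaplacian_iff`). The operator `T` is Hilbert–Schmidt,
and for `M = V + ‖V‖ ≥ 0` the resolvent `(H + ‖V‖)⁻¹ = T† (1 + T M T†)⁻¹ T` is compact and symmetric. Its
eigenvectors form a Hilbert basis in which `H` is diagonal, and the spectral projections of a
diagonal operator are the projections onto the closed spans of basis vectors.
-/

theorem integrable_id_of_lintegral_sq {μ : Measure ℝ} [IsFiniteMeasure μ]
    (h : ∫⁻ t, ENNReal.ofReal (t ^ 2) ∂μ < ∞) : Integrable (fun t : ℝ => t) μ := by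
  have h2 : MemLp (fun t : ℝ => t) 2 μ := by
    refine (memLp_two_iff_integrable_sq measurable_id.aestronglyMeasurable).mpr
      ⟨(measurable_id.pow_const 2).aestronglyMeasurable, ?_⟩
    exact (hasFiniteIntegral_iff_ofReal (Filter.Eventually.of_forall fun t => sq_nonneg t)).mpr h
  exact h2.integrable (by norm_num)

theorem isFiniteMeasure_scalarMeasure {H : Type*} [NormedAddCommGroup H] [InnerProductSpace ℂ H]
    [CompleteSpace H] (P : ProjectionValuedMeasure H) (ψ : H) :
    IsFiniteMeasure (P.scalarMeasure ψ) :=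
  ⟨by rw [P.scalarMeasure_apply _ MeasurableSet.univ]; exact ENNReal.ofReal_lt_top⟩

/-! ### Operators that are diagonal in a Hilbert basis -/

section Diagonal

variable {H : Type*} [NormedAddCommGroup H] [InnerProductSpace ℂ H] {ι : Type*}

theorem HilbertBasis.ext_inner (b : HilbertBasis ι ℂ H) {x y : H}
    (h : ∀ i, ⟪b i, x⟫_ℂ = ⟪b i, y⟫_ℂ) : x = y := by
  apply b.repr.injective
  ext i
  simpa [b.repr_apply_apply] using h i

theorem HilbertBasis.hasSum_norm_sq (b : HilbertBasis ι ℂ H) (x : H) :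
    HasSum (fun i => ‖⟪b i, x⟫_ℂ‖ ^ 2) (‖x‖ ^ 2) := by
  have h := b.hasSum_inner_mul_inner x x
  rw [inner_self_eq_norm_sq_to_K] at h
  have h2 : ∀ i, ⟪x, b i⟫_ℂ * ⟪b i, x⟫_ℂ = ((‖⟪b i, x⟫_ℂ‖ ^ 2 : ℝ) : ℂ) := by
    intro i
    rw [← inner_conj_symm, RCLike.conj_mul]
    norm_cast
  simp only [h2] at h
  refine Complex.hasSum_ofReal.mp ?_
  simpa using h

theorem HilbertBasis.ofReal_norm_sq (b : HilbertBasis ι ℂ H) (x : H) :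
    ENNReal.ofReal (‖x‖ ^ 2) = ∑' i, ENNReal.ofReal (‖⟪b i, x⟫_ℂ‖ ^ 2) := by
  have h := b.hasSum_norm_sq x
  rw [← h.tsum_eq, ENNReal.ofReal_tsum_of_nonneg (fun n => by positivity) h.summable]

/-- The closed span of the basis vectors `b i` with `i ∈ S`, described by the vanishing of the
other coordinates. -/
def HilbertBasis.coordSubspace (b : HilbertBasis ι ℂ H) (S : Set ι) : Submodule ℂ H where
  carrier := {x | ∀ i ∉ S, ⟪b i, x⟫_ℂ = 0}
  zero_mem' i _ := inner_zero_right _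
  add_mem' hx hy i hi := by rw [inner_add_right, hx i hi, hy i hi, add_zero]
  smul_mem' c x hx i hi := by rw [inner_smul_right, hx i hi, mul_zero]

theorem HilbertBasis.isClosed_coordSubspace (b : HilbertBasis ι ℂ H) (S : Set ι) :
    IsClosed (b.coordSubspace S : Set H) := by
  have : (b.coordSubspace S : Set H) = ⋂ i ∈ Sᶜ, {x | ⟪b i, x⟫_ℂ = 0} := by
    ext x
    simp [HilbertBasis.coordSubspace]
  rw [this]
  exact isClosed_biInter fun i _ =>
    isClosed_eq (continuous_const.inner continuous_id) continuous_const

variable [CompleteSpace H]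

instance (b : HilbertBasis ι ℂ H) (S : Set ι) : (b.coordSubspace S).HasOrthogonalProjection :=
  haveI := (b.isClosed_coordSubspace S).completeSpace_coe
  inferInstance

theorem HilbertBasis.inner_starProjection_coordSubspace (b : HilbertBasis ι ℂ H) (S : Set ι)
    [DecidablePred (· ∈ S)] (i : ι) (x : H) :
    ⟪b i, (b.coordSubspace S).starProjection x⟫_ℂ = if i ∈ S then ⟪b i, x⟫_ℂ else 0 := by
  split_ifs with hi
  · have hb : b i ∈ b.coordSubspace S := fun j hj =>
      b.orthonormal.2 (fun h => hj (h ▸ hi))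
    rw [← Submodule.inner_starProjection_left_eq_right,
      Submodule.starProjection_eq_self_iff.mpr hb]
  · exact (b.coordSubspace S).starProjection_apply_mem x i hi

theorem HilbertBasis.hasSum_starProjection_coordSubspace (b : HilbertBasis ι ℂ H) (S : Set ι)
    (x : H) :
    HasSum (fun i : S => ⟪b i, x⟫_ℂ • b i) ((b.coordSubspace S).starProjection x) := by
  classical
  have h := b.hasSum_repr ((b.coordSubspace S).starProjection x)
  refine (hasSum_subtype_iff_indicator (f := fun i => ⟪b i, x⟫_ℂ • b i)).mpr ?_
  convert h using 2 with i
  rw [b.repr_apply_apply, b.inner_starProjection_coordSubspace, Set.indicator_apply]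
  split_ifs <;> simp

/-- The projection-valued measure of the operator with eigenbasis `b` and eigenvalues `lam`. -/
noncomputable def diagonalMeasure (b : HilbertBasis ι ℂ H) (lam : ι → ℝ) :
    ProjectionValuedMeasure H where
  proj B := (b.coordSubspace (lam ⁻¹' B)).starProjection
  isStarProjection B _ := isStarProjection_starProjection
  proj_univ := by
    classical
    ext x
    refine b.ext_inner fun i => ?_
    rw [b.inner_starProjection_coordSubspace]
    simp
  proj_inter B C _ _ := by
    classical
    ext x
    refine b.ext_inner fun i => ?_
    simp only [mul_apply_eq_comp, b.inner_starProjection_coordSubspace,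
      mem_preimage, mem_inter_iff]
    split_ifs <;> simp_all
  hasSum_proj B _ hd ψ := by
    have hd' : Pairwise (Function.onFun Disjoint fun n => lam ⁻¹' B n) :=
      fun m n hmn => (hd hmn).preimage lam
    have h := b.hasSum_starProjection_coordSubspace (lam ⁻¹' ⋃ n, B n) ψ
    rw [preimage_iUnion] at h ⊢
    rw [← (Set.unionEqSigmaOfDisjoint hd').symm.hasSum_iff] at h
    refine h.sigma fun n => ?_
    convert b.hasSum_starProjection_coordSubspace (lam ⁻¹' B n) ψ using 2 with i
    simp [Set.coe_unionEqSigmaOfDisjoint_symm_apply]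

theorem scalarMeasure_diagonalMeasure (b : HilbertBasis ι ℂ H) (lam : ι → ℝ) (ψ : H) :
    (diagonalMeasure b lam).scalarMeasure ψ =
      Measure.sum fun i => ENNReal.ofReal (‖⟪b i, ψ⟫_ℂ‖ ^ 2) • Measure.dirac (lam i) := by
  classical
  ext B hB
  rw [ProjectionValuedMeasure.scalarMeasure_apply _ _ hB, Measure.sum_apply _ hB,
    b.ofReal_norm_sq]
  refine tsum_congr fun i => ?_
  rw [diagonalMeasure, b.inner_starProjection_coordSubspace, Measure.smul_apply,
    Measure.dirac_apply' _ hB, Set.indicator_apply]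
  simp only [mem_preimage]
  split_ifs <;> simp

/-- An operator that acts on coordinates as multiplication by `lam`, with maximal domain, has
`diagonalMeasure b lam` as its spectral measure. -/
theorem isSpectralMeasure_diagonalMeasure (b : HilbertBasis ι ℂ H) (lam : ι → ℝ)
    (A : H →ₗ.[ℂ] H)
    (hA : ∀ ψ φ : H, (ψ, φ) ∈ A.graph ↔ ∀ i, ⟪b i, φ⟫_ℂ = lam i * ⟪b i, ψ⟫_ℂ) :
    IsSpectralMeasure A (diagonalMeasure b lam) := by
  have key : ∀ ψ : H, ∫⁻ t, ENNReal.ofReal (t ^ 2) ∂((diagonalMeasure b lam).scalarMeasure ψ)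
      = ∑' i, ENNReal.ofReal (‖(lam i : ℂ) * ⟪b i, ψ⟫_ℂ‖ ^ 2) := by
    intro ψ
    rw [scalarMeasure_diagonalMeasure, lintegral_sum_measure]
    refine tsum_congr fun i => ?_
    rw [lintegral_smul_measure, lintegral_dirac, smul_eq_mul,
      ← ENNReal.ofReal_mul (by positivity), norm_mul, mul_pow, mul_comm]
    simp
  have hdom : ∀ ψ : H, ψ ∈ A.domain ↔
      ∫⁻ t, ENNReal.ofReal (t ^ 2) ∂((diagonalMeasure b lam).scalarMeasure ψ) < ∞ := by
    intro ψ
    rw [key]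
    constructor
    · intro h
      have hg := (hA ψ (A ⟨ψ, h⟩)).mp (A.mem_graph ⟨ψ, h⟩)
      simp only [← hg]
      rw [← b.ofReal_norm_sq]
      exact ENNReal.ofReal_lt_top
    · intro h
      have hs : Summable fun i => ‖(lam i : ℂ) * ⟪b i, ψ⟫_ℂ‖ ^ 2 := by
        have := ENNReal.summable_toReal h.ne
        refine this.congr fun i => ENNReal.toReal_ofReal (by positivity)
      have hm : Memℓp (fun i => (lam i : ℂ) * ⟪b i, ψ⟫_ℂ) 2 := by
        refine memℓp_gen ?_
        simpa using hs
      have hg := (hA ψ (b.repr.symm ⟨_, hm⟩)).mpr fun i => by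
        rw [← b.repr_apply_apply, LinearIsometryEquiv.apply_symm_apply]
      exact LinearPMap.mem_domain_of_mem_graph hg
  refine ⟨hdom, fun ψ => ?_⟩
  have hg := (hA ψ (A ψ)).mp (A.mem_graph ψ)
  have hfin := isFiniteMeasure_scalarMeasure (diagonalMeasure b lam) (ψ : H)
  have hint : Integrable (fun t : ℝ => t) ((diagonalMeasure b lam).scalarMeasure (ψ : H)) :=
    integrable_id_of_lintegral_sq ((hdom ψ).mp ψ.2)
  rw [scalarMeasure_diagonalMeasure] at hint ⊢
  have hs := hasSum_integral_measure hint
  have h1 := b.hasSum_inner_mul_inner (ψ : H) (A ψ)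
  have heq : (fun i => ⟪(ψ : H), b i⟫_ℂ * ⟪b i, A ψ⟫_ℂ) = fun i =>
      ((∫ t, t ∂(ENNReal.ofReal (‖⟪b i, (ψ : H)⟫_ℂ‖ ^ 2) • Measure.dirac (lam i)) : ℝ) : ℂ) := by
    funext i
    rw [hg i, integral_smul_measure, integral_dirac, ENNReal.toReal_ofReal (by positivity),
      ← inner_conj_symm]
    have : (starRingEnd ℂ) ⟪b i, (ψ : H)⟫_ℂ * ⟪b i, (ψ : H)⟫_ℂ
        = ((‖⟪b i, (ψ : H)⟫_ℂ‖ ^ 2 : ℝ) : ℂ) := by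
      rw [RCLike.conj_mul]; norm_cast
    rw [smul_eq_mul, Complex.ofReal_mul, ← this]
    ring
  rw [heq] at h1
  exact h1.unique (Complex.hasSum_ofReal.mpr hs)

/-- Hilbert bases of the members of an orthogonal family with dense span glue to a Hilbert basis of
the whole space. -/
theorem OrthogonalFamily.exists_hilbertBasis {J : Type*} {G : J → Submodule ℂ H}
    [∀ j, CompleteSpace (G j)] (hG : OrthogonalFamily ℂ (fun j => G j) fun j => (G j).subtypeₗᵢ)
    (hbot : (⨆ j, G j)ᗮ = ⊥) :
    ∃ (w : ∀ j, Set (G j)) (b : HilbertBasis (Σ j, w j) ℂ H), ∀ a, b a ∈ G a.1 := by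
  choose w e he using fun j => _root_.exists_hilbertBasis ℂ (G j)
  have hon : Orthonormal ℂ fun a : Σ j, w j => ((e a.1 a.2 : G a.1) : H) :=
    hG.orthonormal_sigma_orthonormal (v_family := fun j => ⇑(e j)) fun j => (e j).orthonormal
  have hbot' : (Submodule.span ℂ
      (Set.range fun a : Σ j, w j => ((e a.1 a.2 : G a.1) : H)))ᗮ = ⊥ := by
    rw [eq_bot_iff, ← hbot]
    intro x hx
    rw [Submodule.mem_orthogonal] at hx
    rw [← Submodule.iInf_orthogonal, Submodule.mem_iInf]
    intro j
    have hx' : (G j).orthogonalProjectionOnto x = 0 := by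
      refine (e j).ext_inner fun i => ?_
      rw [inner_zero_right, Submodule.inner_orthogonalProjectionOnto_eq_of_mem_left]
      exact hx _ (Submodule.subset_span ⟨⟨j, i⟩, rfl⟩)
    rw [← Submodule.starProjection_apply_eq_zero_iff, Submodule.starProjection_apply, hx',
      Submodule.coe_zero]
  exact ⟨w, HilbertBasis.mkOfOrthogonalEqBot hon hbot', fun a => by
    rw [HilbertBasis.coe_mkOfOrthogonalEqBot]
    exact (e a.1 a.2).2⟩

theorem completeSpace_eigenspace (K : H →L[ℂ] H) (μ : ℂ) :
    CompleteSpace (Module.End.eigenspace (K : H →ₗ[ℂ] H) μ) := by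
  have : (Module.End.eigenspace (K : H →ₗ[ℂ] H) μ : Set H) = {x | K x = μ • x} := by
    ext x
    exact Module.End.mem_eigenspace_iff
  have hcl : IsClosed (Module.End.eigenspace (K : H →ₗ[ℂ] H) μ : Set H) := by
    rw [this]
    exact isClosed_eq K.continuous (continuous_id.const_smul μ)
  exact hcl.completeSpace_coe

/-- A compact symmetric operator has a Hilbert basis of eigenvectors. -/
theorem exists_hilbertBasis_eigenvectors {K : H →L[ℂ] H} (hK : IsCompactOperator K)
    (hsymm : (K : H →ₗ[ℂ] H).IsSymmetric) :
    ∃ (w : ∀ μ : ℂ, Set (Module.End.eigenspace (K : H →ₗ[ℂ] H) μ))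
      (b : HilbertBasis (Σ μ, w μ) ℂ H), ∀ a, K (b a) = a.1 • b a := by
  have hcomp := completeSpace_eigenspace K
  have h1 := hsymm.orthogonalFamily_eigenspaces
  have h2 := (ContinuousLinearMap.orthogonalComplement_iSup_eigenspaces_eq_bot hK hsymm)
  obtain ⟨w, b, hb⟩ := OrthogonalFamily.exists_hilbertBasis h1 h2
  exact ⟨w, b, fun a => Module.End.mem_eigenspace_iff.mp (hb a)⟩

end Diagonal

/-! ### Consequences of the spectral representation -/

section Spectral

variable {H : Type*} [NormedAddCommGroup H] [InnerProductSpace ℂ H]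

/-- An operator whose quadratic form is real is symmetric; only the real parts are compared. -/
theorem LinearPMap.re_inner_comm_of_im_eq_zero {A : H →ₗ.[ℂ] H}
    (hA : ∀ x : A.domain, (⟪(x : H), A x⟫_ℂ).im = 0) (x y : A.domain) :
    (⟪(x : H), A y⟫_ℂ).re = (⟪(y : H), A x⟫_ℂ).re := by
  have h := hA (x + Complex.I • y)
  simp only [A.map_add, A.map_smul, Submodule.coe_add, Submodule.coe_smul, inner_add_left,
    inner_add_right, inner_smul_left, inner_smul_right, Complex.add_im, Complex.mul_im,
    Complex.mul_re, Complex.conj_I, Complex.neg_re, Complex.neg_im, Complex.I_re, Complex.I_im,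
    Complex.add_re, hA x, hA y] at h
  linarith

variable [CompleteSpace H]

namespace ProjectionValuedMeasure

variable (P : ProjectionValuedMeasure H)

theorem proj_compl_apply {C : Set ℝ} (hC : MeasurableSet C) (ψ : H) :
    P.proj Cᶜ ψ = ψ - P.proj C ψ := by
  have hd : Pairwise (Function.onFun Disjoint
      fun n : ℕ => if n = 0 then C else if n = 1 then Cᶜ else ∅) := by
    intro m n hmn
    simp only [Function.onFun]
    split_ifs <;> simp_all [disjoint_compl_right, disjoint_compl_left]
  have hm : ∀ n : ℕ, MeasurableSet (if n = 0 then C else if n = 1 then Cᶜ else ∅) := by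
    intro n
    split_ifs
    exacts [hC, hC.compl, MeasurableSet.empty]
  have hU : (⋃ n : ℕ, if n = 0 then C else if n = 1 then Cᶜ else ∅) = univ := by
    refine eq_univ_of_forall fun x => mem_iUnion.mpr ?_
    by_cases hx : x ∈ C
    · exact ⟨0, by simpa using hx⟩
    · exact ⟨1, by simpa using hx⟩
  have h := P.hasSum_proj _ hm hd ψ
  rw [hU, P.proj_univ] at h
  have h2 := hasSum_sum_of_ne_finset_zero
    (f := fun n : ℕ => P.proj (if n = 0 then C else if n = 1 then Cᶜ else ∅) ψ)
    (s := Finset.range 2) (L := SummationFilter.unconditional ℕ) (fun n hn => by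
      have h0 : n ≠ 0 := by rintro rfl; simp at hn
      have h1 : n ≠ 1 := by rintro rfl; simp at hn
      simp [h0, h1, P.proj_empty])
  have h3 := h.unique h2
  rw [Finset.sum_range_succ, Finset.sum_range_one] at h3
  simp only [one_apply_eq_self, if_true, one_ne_zero, if_false] at h3
  exact eq_sub_of_add_eq' h3.symm

/-- The spectral measure of a projected vector is the restriction of that of the vector. -/
theorem scalarMeasure_proj {C : Set ℝ} (hC : MeasurableSet C) (ψ : H) :
    P.scalarMeasure (P.proj C ψ) = (P.scalarMeasure ψ).restrict C := by
  ext B hB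
  rw [P.scalarMeasure_apply _ hB, Measure.restrict_apply hB,
    P.scalarMeasure_apply _ (hB.inter hC), P.proj_inter B C hB hC]
  rfl

theorem proj_proj {C : Set ℝ} (hC : MeasurableSet C) (ψ : H) :
    P.proj C (P.proj C ψ) = P.proj C ψ :=
  congrArg (fun T : H →L[ℂ] H => T ψ) (P.isStarProjection C hC).isIdempotentElem.eq

theorem inner_proj_left {C : Set ℝ} (hC : MeasurableSet C) (φ ψ : H) :
    ⟪P.proj C φ, ψ⟫_ℂ = ⟪φ, P.proj C ψ⟫_ℂ :=
  (ContinuousLinearMap.isSelfAdjoint_iff_isSymmetric.mp (P.isStarProjection C hC).isSelfAdjoint)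
    φ ψ

end ProjectionValuedMeasure

namespace IsSpectralMeasure

variable {A : H →ₗ.[ℂ] H} {P : ProjectionValuedMeasure H}

theorem proj_mem_domain (h : IsSpectralMeasure A P) {C : Set ℝ} (hC : MeasurableSet C) {ψ : H}
    (hψ : ψ ∈ A.domain) : P.proj C ψ ∈ A.domain := by
  rw [h.mem_domain_iff, P.scalarMeasure_proj hC]
  exact (lintegral_mono' Measure.restrict_le_self le_rfl).trans_lt ((h.mem_domain_iff ψ).mp hψ)

theorem proj_mem_domain_of_subset (h : IsSpectralMeasure A P) {C : Set ℝ} (hC : MeasurableSet C)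
    {R : ℝ} (hR : ∀ t ∈ C, |t| ≤ R) (ψ : H) : P.proj C ψ ∈ A.domain := by
  have := isFiniteMeasure_scalarMeasure P ψ
  rw [h.mem_domain_iff, P.scalarMeasure_proj hC]
  refine (setLIntegral_mono (g := fun _ => ENNReal.ofReal (R ^ 2)) measurable_const
    fun t ht => ENNReal.ofReal_le_ofReal ?_).trans_lt ?_
  · exact sq_le_sq' (neg_le_of_abs_le (hR t ht)) (le_of_abs_le (hR t ht))
  · rw [lintegral_const]
    exact ENNReal.mul_lt_top ENNReal.ofReal_lt_top (measure_lt_top _ _)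

/-- The projections of a vector onto the energies `t` with `n ≤ |t| < n + 1` lie in the domain and sum
to the vector. -/
theorem dense_domain (h : IsSpectralMeasure A P) : Dense (A.domain : Set H) := by
  intro ψ
  have hd : Pairwise (Function.onFun Disjoint fun n : ℕ => (fun t : ℝ => ⌊|t|⌋₊) ⁻¹' {n}) :=
    fun m n hmn => Disjoint.preimage _ (by simpa using hmn)
  have hm : ∀ n : ℕ, MeasurableSet ((fun t : ℝ => ⌊|t|⌋₊) ⁻¹' {n}) := fun n =>
    (Nat.measurable_floor.comp measurable_id.abs) (measurableSet_singleton n)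
  have hs := P.hasSum_proj _ hm hd ψ
  have hU : (⋃ n : ℕ, (fun t : ℝ => ⌊|t|⌋₊) ⁻¹' {n}) = univ :=
    eq_univ_of_forall fun t => mem_iUnion.mpr ⟨_, rfl⟩
  rw [hU, P.proj_univ] at hs
  refine mem_closure_of_tendsto hs (Filter.Eventually.of_forall fun s => ?_)
  refine A.domain.sum_mem fun n _ => h.proj_mem_domain_of_subset (R := n + 1) (hm n) ?_ ψ
  intro t ht
  have ht' : ⌊|t|⌋₊ = n := ht
  exact ht' ▸ (Nat.lt_floor_add_one |t|).le

theorem im_inner_eq_zero (h : IsSpectralMeasure A P) (x : A.domain) :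
    (⟪(x : H), A x⟫_ℂ).im = 0 := by
  rw [h.inner_apply, Complex.ofReal_im]

/-- The quadratic form of the operator splits along a spectral projection. -/
theorem inner_eq_add (h : IsSpectralMeasure A P) {C : Set ℝ} (hC : MeasurableSet C)
    {x y : A.domain} (hx : P.proj C x = x) (hy : P.proj C y = 0) :
    ⟪((x + y : A.domain) : H), A (x + y)⟫_ℂ = ⟪(x : H), A x⟫_ℂ + ⟪(y : H), A y⟫_ℂ := by
  have hx' : (x : H) = P.proj C ((x + y : A.domain) : H) := by
    rw [Submodule.coe_add, map_add, hx, hy, add_zero]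
  have hy' : (y : H) = P.proj Cᶜ ((x + y : A.domain) : H) := by
    rw [P.proj_compl_apply hC, ← hx', Submodule.coe_add, add_sub_cancel_left]
  have hfin := isFiniteMeasure_scalarMeasure P ((x + y : A.domain) : H)
  have hint := integrable_id_of_lintegral_sq ((h.mem_domain_iff _).mp (x + y).2)
  rw [h.inner_apply, h.inner_apply, h.inner_apply]
  conv_rhs => rw [hx', hy']
  rw [P.scalarMeasure_proj hC, P.scalarMeasure_proj hC.compl, ← Complex.ofReal_add,
    integral_add_compl hC hint]

theorem inner_eq_zero_of_proj (h : IsSpectralMeasure A P) {C : Set ℝ} (hC : MeasurableSet C)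
    {x y : A.domain} (hx : P.proj C x = x) (hy : P.proj C y = 0) : ⟪(y : H), A x⟫_ℂ = 0 := by
  have h1 := h.inner_eq_add hC hx hy
  have h2 := h.inner_eq_add hC (y := Complex.I • y) hx (by
    rw [Submodule.coe_smul, map_smul, hy, smul_zero])
  simp only [A.map_add, A.map_smul, Submodule.coe_add, Submodule.coe_smul, inner_add_left,
    inner_add_right, inner_smul_left, inner_smul_right, Complex.conj_I] at h1 h2
  have h1' : ⟪(x : H), A y⟫_ℂ + ⟪(y : H), A x⟫_ℂ = 0 := by linear_combination h1
  have h2' : Complex.I * (⟪(x : H), A y⟫_ℂ - ⟪(y : H), A x⟫_ℂ) = 0 := by linear_combination h2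
  have h3 := (mul_eq_zero.mp h2').resolve_left Complex.I_ne_zero
  linear_combination (h1' - h3) / 2

/-- The operator leaves the range of each spectral projection invariant. -/
theorem proj_apply_eq (h : IsSpectralMeasure A P) {C : Set ℝ} (hC : MeasurableSet C)
    {x : A.domain} (hx : P.proj C x = x) : P.proj C (A x) = A x := by
  refine (sub_eq_zero.mp (h.dense_domain.eq_zero_of_inner_right ℂ fun z hzd => ?_)).symm
  have hz := h.proj_mem_domain hC hzd
  have hz' : P.proj C ((⟨z, hzd⟩ - ⟨_, hz⟩ : A.domain) : H) = 0 := by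
    rw [Submodule.coe_sub, map_sub, P.proj_proj hC, sub_self]
  have := h.inner_eq_zero_of_proj hC hx hz'
  rw [Submodule.coe_sub, inner_sub_left, P.inner_proj_left hC] at this
  rw [inner_sub_right]
  exact this

/-- On the range of the spectral projection of `[E₁, E₂]` the quadratic form lies between `E₁` and
`E₂`. -/
theorem re_inner_mem_Icc (h : IsSpectralMeasure A P) {E₁ E₂ : ℝ} {x : A.domain}
    (hx : P.proj (Icc E₁ E₂) x = x) :
    (⟪(x : H), A x⟫_ℂ).re ∈ Icc (E₁ * ‖(x : H)‖ ^ 2) (E₂ * ‖(x : H)‖ ^ 2) := by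
  have hfin := isFiniteMeasure_scalarMeasure P (x : H)
  have hint := integrable_id_of_lintegral_sq ((h.mem_domain_iff _).mp x.2)
  have hr : (P.scalarMeasure (x : H)).restrict (Icc E₁ E₂) = P.scalarMeasure (x : H) := by
    rw [← P.scalarMeasure_proj measurableSet_Icc, hx]
  have hmass : (P.scalarMeasure (x : H)).real (Icc E₁ E₂) = ‖(x : H)‖ ^ 2 := by
    rw [Measure.real, P.scalarMeasure_apply _ measurableSet_Icc, hx,
      ENNReal.toReal_ofReal (by positivity)]
  rw [h.inner_apply, Complex.ofReal_re, ← hr]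
  constructor
  · calc E₁ * ‖(x : H)‖ ^ 2 = ∫ _ in Icc E₁ E₂, E₁ ∂(P.scalarMeasure (x : H)) := by
          rw [setIntegral_const, hmass, smul_eq_mul, mul_comm]
      _ ≤ _ := setIntegral_mono_on (integrable_const _) hint.integrableOn measurableSet_Icc
          fun t ht => ht.1
  · calc _ ≤ ∫ _ in Icc E₁ E₂, E₂ ∂(P.scalarMeasure (x : H)) :=
          setIntegral_mono_on hint.integrableOn (integrable_const _) measurableSet_Icc
          fun t ht => ht.2
      _ = _ := by rw [setIntegral_const, hmass, smul_eq_mul, mul_comm]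

/-- Vectors in the spectral subspace of a short energy interval are approximate eigenvectors. -/
theorem norm_sub_smul_le (h : IsSpectralMeasure A P) {E ε : ℝ} (hε : 0 ≤ ε) {x : A.domain}
    (hx : P.proj (Icc E (E + ε)) x = x) :
    ‖A x - (E : ℂ) • (x : H)‖ ≤ ε * ‖(x : H)‖ := by
  set φ : H := A x - (E : ℂ) • (x : H) with hφ
  rcases eq_or_ne φ 0 with h0 | h0
  · rw [h0, norm_zero]; positivity
  rcases eq_or_ne (x : H) 0 with hx0 | hx0
  · have : x = 0 := Subtype.ext hx0
    subst this
    simp [hφ]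
  have hφp : P.proj (Icc E (E + ε)) φ = φ := by
    rw [hφ, map_sub, map_smul, h.proj_apply_eq measurableSet_Icc hx, hx]
  have hφd : φ ∈ A.domain := by
    rw [← hφp]
    refine h.proj_mem_domain_of_subset (R := max |E| |E + ε|) measurableSet_Icc
      (fun t ht => abs_le_max_abs_abs ht.1 ht.2) φ
  have hnφ : 0 < ‖φ‖ := norm_pos_iff.mpr h0
  have hnx : 0 < ‖(x : H)‖ := norm_pos_iff.mpr hx0
  -- `y` is the multiple of `φ` that has the norm of `x`
  set r : ℝ := ‖(x : H)‖ / ‖φ‖ with hr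
  set y : A.domain := (r : ℂ) • ⟨φ, hφd⟩ with hy
  have hyn : ‖(y : H)‖ = ‖(x : H)‖ := by
    rw [hy, Submodule.coe_smul, norm_smul, Complex.norm_real, Real.norm_eq_abs, hr,
      abs_of_nonneg (by positivity)]
    field_simp
  have hyp : P.proj (Icc E (E + ε)) y = y := by
    rw [hy, Submodule.coe_smul, map_smul, hφp]
  have hxy : (⟪(y : H), A x - (E : ℂ) • (x : H)⟫_ℂ).re = ‖(x : H)‖ * ‖φ‖ := by
    rw [← hφ, hy, Submodule.coe_smul, inner_smul_left, inner_self_eq_norm_sq_to_K,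
      Complex.conj_ofReal]
    have : ((r : ℂ) * ((‖φ‖ : ℝ) : ℂ) ^ 2).re = r * ‖φ‖ ^ 2 := by
      rw [← Complex.ofReal_pow, ← Complex.ofReal_mul, Complex.ofReal_re]
    refine this.trans ?_
    rw [hr]; field_simp
  have hp := (h.re_inner_mem_Icc (x := x + y) (by
    rw [Submodule.coe_add, map_add, hx, hyp])).2
  have hm := (h.re_inner_mem_Icc (x := x - y) (by
    rw [Submodule.coe_sub, map_sub, hx, hyp])).1
  have hsym := LinearPMap.re_inner_comm_of_im_eq_zero h.im_inner_eq_zero x y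
  have hn1 : ‖(x : H) + y‖ ^ 2 = ‖(x : H)‖ ^ 2 + 2 * (⟪(y : H), (x : H)⟫_ℂ).re + ‖(x : H)‖ ^ 2 := by
    rw [norm_add_sq (𝕜 := ℂ), hyn, inner_re_symm]; rfl
  have hn2 : ‖(x : H) - y‖ ^ 2 = ‖(x : H)‖ ^ 2 - 2 * (⟪(y : H), (x : H)⟫_ℂ).re + ‖(x : H)‖ ^ 2 := by
    rw [norm_sub_sq (𝕜 := ℂ), hyn, inner_re_symm]; rfl
  have hle : ‖(x : H) + y‖ ^ 2 ≤ (2 * ‖(x : H)‖) ^ 2 := by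
    refine pow_le_pow_left₀ (norm_nonneg _) ((norm_add_le _ _).trans ?_) 2
    rw [hyn]; linarith
  simp only [A.map_add, A.map_sub, Submodule.coe_add, Submodule.coe_sub, inner_add_left,
    inner_add_right, inner_sub_left, inner_sub_right, inner_smul_right, Complex.add_re,
    Complex.sub_re, Complex.re_ofReal_mul] at hp hm hxy
  rw [hn2] at hm
  have hεle := mul_le_mul_of_nonneg_left hle hε
  have h4 : 4 * (‖(x : H)‖ * ‖φ‖) ≤ ε * (2 * ‖(x : H)‖) ^ 2 := by
    have hp' : _ ≤ E * ‖(x : H) + y‖ ^ 2 + ε * ‖(x : H) + y‖ ^ 2 := hp.trans_eq (add_mul _ _ _)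
    rw [hn1] at hp'
    rw [hn1] at hεle
    linarith
  refine le_of_mul_le_mul_left ?_ hnx
  nlinarith

end IsSpectralMeasure

/-- The trace of an orthogonal projection is at most `n` if its range contains no more than `n`
linearly independent vectors. -/
theorem traceNonneg_le_of_linearIndependent {p : H →L[ℂ] H} (hp : IsStarProjection p) {n : ℕ}
    (hn : ∀ (m : ℕ) (v : Fin m → H), (∀ i, p (v i) = v i) → LinearIndependent ℂ v → m ≤ n) :
    traceNonneg p ≤ n := by
  obtain ⟨hW, hpW⟩ := isStarProjection_iff_eq_starProjection_range.mp hp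
  set W := p.range with hWdef
  have hpx : ∀ x ∈ W, p x = x := fun x hx => by
    rw [hpW]; exact Submodule.starProjection_eq_self_iff.mpr hx
  have hrank : Module.rank ℂ W ≤ n := by
    refine rank_le fun s hs => ?_
    exact hn s.card (fun i => ((s.equivFin.symm i : W) : H)) (fun i => hpx _ (Subtype.property _))
      ((hs.map' W.subtype W.ker_subtype).comp _ s.equivFin.symm.injective)
  have hfin : FiniteDimensional ℂ W :=
    Module.rank_lt_aleph0_iff.mp (hrank.trans_lt Cardinal.natCast_lt_aleph0)
  have hfr : Module.finrank ℂ W ≤ n := Module.finrank_le_of_rank_le hrank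
  set f := stdOrthonormalBasis ℂ W
  obtain ⟨e, he⟩ := (exists_hilbertBasis ℂ H).choose_spec
  have key : ∀ x : H, ENNReal.ofReal (RCLike.re ⟪x, p x⟫_ℂ)
      = ∑ j, ENNReal.ofReal (‖⟪x, (f j : H)⟫_ℂ‖ ^ 2) := by
    intro x
    rw [← ENNReal.ofReal_sum_of_nonneg (fun _ _ => by positivity)]
    congr 1
    have : p x = (W.orthogonalProjectionOnto x : H) := by
      conv_lhs => rw [hpW]
      rfl
    rw [this, ← Submodule.inner_orthogonalProjectionOnto_eq_of_mem_right,
      inner_self_eq_norm_sq, ← f.sum_sq_norm_inner_left]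
    simp only [Submodule.inner_orthogonalProjectionOnto_eq_of_mem_right]
  rw [traceNonneg]
  simp only [key]
  rw [Summable.tsum_finsetSum (fun _ _ => ENNReal.summable)]
  have h1 : ∀ j, ∑' x : (exists_hilbertBasis ℂ H).choose,
      ENNReal.ofReal (‖⟪(x : H), (f j : H)⟫_ℂ‖ ^ 2) = 1 := by
    intro j
    have := e.ofReal_norm_sq (f j : H)
    rw [he] at this
    have hf : ‖(f j : H)‖ = 1 := f.norm_eq_one j
    rw [← this, hf]
    simp
  simp only [h1]
  simpa using hfr

end Spectral

/-! ### Existence of spectral measures for operators with compact resolvent -/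

section Resolvent

variable {H : Type*} [NormedAddCommGroup H] [InnerProductSpace ℂ H] [CompleteSpace H]

/-- An operator with a compact symmetric resolvent `(A + c)⁻¹ = K` has a spectral measure. -/
theorem exists_isSpectralMeasure_of_resolvent {A : H →ₗ.[ℂ] H} {K : H →L[ℂ] H}
    (hK : IsCompactOperator K) (hsymm : (K : H →ₗ[ℂ] H).IsSymmetric) (c : ℝ)
    (hA : ∀ ψ φ : H, (ψ, φ) ∈ A.graph ↔ K (φ + (c : ℂ) • ψ) = ψ) :
    ∃ P : ProjectionValuedMeasure H, IsSpectralMeasure A P := by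
  obtain ⟨w, b, hb⟩ := exists_hilbertBasis_eigenvectors hK hsymm
  have hinj : ∀ x, K x = 0 → x = 0 := fun x hx =>
    A.graph_fst_eq_zero_snd ((hA 0 x).mpr (by simpa using hx)) rfl
  have hb0 : ∀ i, b i ≠ 0 := fun i => b.orthonormal.ne_zero i
  have hne : ∀ i : Σ μ, w μ, i.1 ≠ 0 := fun i h0 =>
    hb0 i (hinj _ (by rw [hb, h0, zero_smul]))
  have hreal : ∀ i : Σ μ, w μ, ((i.1.re : ℝ) : ℂ) = i.1 := fun i =>
    Complex.conj_eq_iff_re.mp (hsymm.conj_eigenvalue_eq_self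
      (Module.End.hasEigenvalue_of_hasEigenvector
        ⟨Module.End.mem_eigenspace_iff.mpr (hb i), hb0 i⟩))
  refine ⟨diagonalMeasure b fun i => i.1.re⁻¹ - c, isSpectralMeasure_diagonalMeasure b _ A ?_⟩
  intro ψ φ
  have hcoord : ∀ x i, ⟪b i, K x⟫_ℂ = i.1 * ⟪b i, x⟫_ℂ := by
    intro x i
    have h1 : ⟪b i, K x⟫_ℂ = ⟪K (b i), x⟫_ℂ := (hsymm (b i) x).symm
    rw [h1, hb, inner_smul_left, ← hreal, Complex.conj_ofReal]
  have key : ∀ i : Σ μ, w μ, ⟪b i, φ⟫_ℂ = ((i.1.re⁻¹ - c : ℝ) : ℂ) * ⟪b i, ψ⟫_ℂ ↔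
      ⟪b i, K (φ + (c : ℂ) • ψ)⟫_ℂ = ⟪b i, ψ⟫_ℂ := by
    intro i
    rw [hcoord, inner_add_right, inner_smul_right]
    push_cast
    rw [hreal]
    have := hne i
    constructor
    · intro h
      rw [h]
      field_simp
      ring
    · intro h
      have h' : ⟪b i, φ⟫_ℂ = i.1⁻¹ * ⟪b i, ψ⟫_ℂ - c * ⟪b i, ψ⟫_ℂ := by
        rw [eq_sub_iff_add_eq, eq_inv_mul_iff_mul_eq₀ this, h]
      rw [h']
      ring
  rw [hA]
  constructor
  · intro h i
    rw [key, h]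
  · intro h
    exact b.ext_inner fun i => (key i).mp (h i)

theorem isUnit_one_add_of_isPositive {N : H →L[ℂ] H} (hN : N.IsPositive) : IsUnit (1 + N) := by
  have h0 : 0 ≤ N := (ContinuousLinearMap.nonneg_iff_isPositive N).mpr hN
  have h1 : (-1 : ℝ) ∉ spectrum ℝ N := fun h => by
    have := spectrum_nonneg_of_nonneg h0 h
    linarith
  rw [spectrum.notMem_iff, map_neg, map_one] at h1
  have := h1.neg
  rwa [neg_sub, sub_neg_eq_add, add_comm] at this

/-- If `A + c = (T†T)⁻¹ + M` with `T` compact and `M` positive, then `A` has a spectral measure, since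
the resolvent `(A + c)⁻¹ = T† (1 + T M T†)⁻¹ T` is compact and symmetric. The inverse of `T†T` is
expressed by the graph of `A`, so that the injectivity of `T†T` is not a hypothesis. -/
theorem exists_isSpectralMeasure_of_isCompactOperator {A : H →ₗ.[ℂ] H} {T M : H →L[ℂ] H}
    (hT : IsCompactOperator T) (hM : M.IsPositive) (c : ℝ)
    (hA : ∀ ψ φ : H, (ψ, φ) ∈ A.graph ↔
      (ContinuousLinearMap.adjoint T) (T (φ + (c : ℂ) • ψ - M ψ)) = ψ) :
    ∃ P : ProjectionValuedMeasure H, IsSpectralMeasure A P := by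
  set T' := ContinuousLinearMap.adjoint T with hT'
  set N : H →L[ℂ] H := T ∘L M ∘L T' with hN
  have hNpos : N.IsPositive := hM.conj_adjoint T
  obtain ⟨⟨N₁, S, h1, h2⟩, rfl : N₁ = 1 + N⟩ := isUnit_one_add_of_isPositive hNpos
  have hl : ∀ x, S x + N (S x) = x := fun x => congrArg (fun R : H →L[ℂ] H => R x) h1
  have hr : ∀ x, S (x + N x) = x := fun x => congrArg (fun R : H →L[ℂ] H => R x) h2
  have hSsymm : ∀ x y, ⟪S x, y⟫_ℂ = ⟪x, S y⟫_ℂ := by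
    intro x y
    conv_lhs => rw [← hl y, inner_add_right, ← hNpos.inner_left_eq_inner_right, ← inner_add_left,
      hl x]
  have hadj : ∀ x y, ⟪T' x, y⟫_ℂ = ⟪x, T y⟫_ℂ :=
    fun x y => T.adjoint_inner_left y x
  have hadj' : ∀ x y, ⟪x, T' y⟫_ℂ = ⟪T x, y⟫_ℂ :=
    fun x y => T.adjoint_inner_right x y
  refine exists_isSpectralMeasure_of_resolvent (K := T' ∘L S ∘L T) ?_ ?_ c fun ψ φ => ?_
  · exact hT.clm_comp (T' ∘L S)
  · intro x y
    change ⟪T' (S (T x)), y⟫_ℂ = ⟪x, T' (S (T y))⟫_ℂ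
    rw [hadj, hadj', hSsymm]
  · rw [hA]
    change _ ↔ T' (S (T (φ + (c : ℂ) • ψ))) = ψ
    set χ := φ + (c : ℂ) • ψ
    constructor
    · intro h
      have h3 : T (χ - M ψ) + N (T (χ - M ψ)) = T χ := by
        change T (χ - M ψ) + T (M (T' (T (χ - M ψ)))) = T χ
        rw [h, map_sub, sub_add_cancel]
      rw [← h3, hr, h]
    · intro h
      have h3 : T (χ - M ψ) = S (T χ) := by
        have h4 := hl (T χ)
        change S (T χ) + T (M (T' (S (T χ)))) = T χ at h4
        rw [h] at h4
        rw [map_sub, sub_eq_iff_eq_add, h4]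
      rw [h3, h]

/-- An operator with square-summable column norms (a Hilbert–Schmidt operator) is compact. -/
theorem isCompactOperator_of_summable_norm_sq {ι : Type*} (b : HilbertBasis ι ℂ H) (J : H →L[ℂ] H)
    (hJ : Summable fun i => ‖J (b i)‖ ^ 2) : IsCompactOperator J := by
  -- the finite rank operators `R F` agree with `J` on the span of `b i`, `i ∈ F`, and converge in norm
  set R : Finset ι → H →L[ℂ] H := fun F => ∑ i ∈ F, (innerSL ℂ (b i)).smulRight (J (b i)) with hR
  have hRapp : ∀ F x, R F x = ∑ i ∈ F, ⟪b i, x⟫_ℂ • J (b i) := by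
    intro F x
    simp [hR]
  have hRc : ∀ F, IsCompactOperator (R F) := by
    intro F
    have : R F ∈ compactOperator (RingHom.id ℂ) H H := by
      refine Submodule.sum_mem _ fun i _ => ?_
      have hc : IsCompactOperator (innerSL ℂ (b i)) :=
        isCompactOperator_of_locallyCompactSpace_dom (innerSL ℂ (b i))
      exact hc.clm_comp (ContinuousLinearMap.toSpanSingleton ℂ (J (b i)))
    exact this
  have hsum : ∀ x, HasSum (fun i => ⟪b i, x⟫_ℂ • J (b i)) (J x) := by
    intro x
    have := (b.hasSum_repr x).mapL J
    simpa [b.repr_apply_apply] using this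
  refine isCompactOperator_of_tendsto (l := Filter.atTop) (F := R) ?_
    (Filter.Eventually.of_forall hRc)
  rw [tendsto_iff_norm_sub_tendsto_zero]
  refine squeeze_zero (g := fun F : Finset ι => √(∑' i, ‖J (b i)‖ ^ 2 - ∑ i ∈ F, ‖J (b i)‖ ^ 2))
    (fun _ => norm_nonneg _) (fun F => ?_) ?_
  · rw [norm_sub_rev]
    refine ContinuousLinearMap.opNorm_le_bound _ (Real.sqrt_nonneg _) fun x => ?_
    have hlim : Filter.Tendsto (fun G : Finset ι => ‖∑ i ∈ G, ⟪b i, x⟫_ℂ • J (b i) - R F x‖)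
        Filter.atTop (nhds ‖J x - R F x‖) := ((hsum x).sub_const (R F x)).norm
    refine le_of_tendsto hlim (Filter.eventually_atTop.mpr ⟨F, fun G hG => ?_⟩)
    classical
    rw [hRapp, ← Finset.sum_sdiff hG, add_sub_cancel_right]
    calc ‖∑ i ∈ G \ F, ⟪b i, x⟫_ℂ • J (b i)‖ ≤ ∑ i ∈ G \ F, ‖J (b i)‖ * ‖⟪b i, x⟫_ℂ‖ := by
          refine (norm_sum_le _ _).trans (Finset.sum_le_sum fun i _ => ?_)
          rw [norm_smul, mul_comm]
      _ ≤ √(∑ i ∈ G \ F, ‖J (b i)‖ ^ 2) * √(∑ i ∈ G \ F, ‖⟪b i, x⟫_ℂ‖ ^ 2) :=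
          Real.sum_mul_le_sqrt_mul_sqrt _ _ _
      _ ≤ _ := by
          gcongr
          · rw [le_sub_iff_add_le, Finset.sum_sdiff hG]
            exact hJ.sum_le_tsum G fun i _ => by positivity
          · refine Real.sqrt_le_iff.mpr ⟨norm_nonneg _, ?_⟩
            exact sum_le_hasSum _ (fun _ _ => by positivity) (b.hasSum_norm_sq x)
  · have := (hJ.hasSum.const_sub (∑' i, ‖J (b i)‖ ^ 2)).sqrt
    simpa using this

end Resolvent

/-! ### Integral operators on `L²` whose kernel is the indicator of a set -/

section IndicatorKernel

variable {α : Type*} [MeasurableSpace α] {μ : Measure α}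

theorem L2.norm_sq_eq_integral (f : Lp ℂ 2 μ) : ‖f‖ ^ 2 = ∫ x, ‖f x‖ ^ 2 ∂μ := by
  have h := L2.inner_def (𝕜 := ℂ) f f
  simp only [inner_self_eq_norm_sq_to_K] at h
  have h2 : (((‖f‖ ^ 2 : ℝ)) : ℂ) = ((∫ x, ‖f x‖ ^ 2 ∂μ : ℝ) : ℂ) := by
    rw [← integral_complex_ofReal]
    simpa using h
  exact_mod_cast h2

variable [IsFiniteMeasure μ]

theorem norm_setIntegral_le_sqrt_mul {s : Set α} (hs : MeasurableSet s) (f : Lp ℂ 2 μ) :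
    ‖∫ t in s, f t ∂μ‖ ≤ √(μ.real s) * ‖f‖ := by
  rw [← L2.inner_indicatorConstLp_one hs (measure_ne_top μ s)]
  refine (norm_inner_le_norm _ _).trans (mul_le_mul_of_nonneg_right ?_ (norm_nonneg _))
  rw [norm_indicatorConstLp (by norm_num) (by norm_num), Real.sqrt_eq_rpow]
  simp

theorem norm_setIntegral_le_sqrt_univ_mul {s : Set α} (hs : MeasurableSet s) (f : Lp ℂ 2 μ) :
    ‖∫ t in s, f t ∂μ‖ ≤ √(μ.real univ) * ‖f‖ :=
  (norm_setIntegral_le_sqrt_mul hs f).trans (mul_le_mul_of_nonneg_right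
    (Real.sqrt_le_sqrt (measureReal_mono (subset_univ _))) (norm_nonneg _))

theorem stronglyMeasurable_setIntegral_section {S : Set (α × α)} (hS : MeasurableSet S)
    (f : Lp ℂ 2 μ) : StronglyMeasurable fun x => ∫ t in Prod.mk x ⁻¹' S, f t ∂μ := by
  have h : StronglyMeasurable (S.indicator fun p : α × α => f p.2) :=
    ((Lp.stronglyMeasurable f).comp_measurable measurable_snd).indicator hS
  convert h.integral_prod_right' (ν := μ) using 2 with x
  rw [← integral_indicator (measurable_prodMk_left hS)]
  rfl

theorem memLp_setIntegral_section {S : Set (α × α)} (hS : MeasurableSet S) (f : Lp ℂ 2 μ) :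
    MemLp (fun x => ∫ t in Prod.mk x ⁻¹' S, f t ∂μ) 2 μ := by
  refine MemLp.of_bound (stronglyMeasurable_setIntegral_section hS f).aestronglyMeasurable
    (√(μ.real univ) * ‖f‖) (Filter.Eventually.of_forall fun x => ?_)
  exact norm_setIntegral_le_sqrt_univ_mul (measurable_prodMk_left hS) f

/-- The integral operator `f ↦ (x ↦ ∫_{(x, t) ∈ S} f(t) dμ(t))` on `L²(μ)`. -/
noncomputable def indicatorKernel (μ : Measure α) [IsFiniteMeasure μ] {S : Set (α × α)}
    (hS : MeasurableSet S) : Lp ℂ 2 μ →L[ℂ] Lp ℂ 2 μ :=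
  LinearMap.mkContinuous
    { toFun := fun f => (memLp_setIntegral_section hS f).toLp _
      map_add' := fun f g => by
        rw [← MemLp.toLp_add]
        refine MemLp.toLp_congr _ _ (Filter.Eventually.of_forall fun x => ?_)
        simp only [Pi.add_apply]
        rw [← integral_add ((Lp.memLp f).integrable (by norm_num)).integrableOn
          ((Lp.memLp g).integrable (by norm_num)).integrableOn]
        exact integral_congr_ae (ae_restrict_of_ae (Lp.coeFn_add f g))
      map_smul' := fun c f => by
        rw [RingHom.id_apply, ← MemLp.toLp_const_smul]
        refine MemLp.toLp_congr _ _ (Filter.Eventually.of_forall fun x => ?_)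
        simp only [Pi.smul_apply]
        rw [← integral_smul]
        exact integral_congr_ae (ae_restrict_of_ae (Lp.coeFn_smul c f)) }
    (√(μ.real univ) * √(μ.real univ)) fun f => by
      refine (Lp.norm_le_of_ae_bound (C := √(μ.real univ) * ‖f‖) (by positivity) ?_).trans_eq ?_
      · filter_upwards [(memLp_setIntegral_section hS f).coeFn_toLp] with x hx
        change ‖((memLp_setIntegral_section hS f).toLp _ : α → ℂ) x‖ ≤ _
        rw [hx]
        exact norm_setIntegral_le_sqrt_univ_mul (measurable_prodMk_left hS) f
      · rw [Real.sqrt_eq_rpow, mul_assoc]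
        simp [measureUnivNNReal, Measure.real]
        exact Or.inl rfl

theorem coeFn_indicatorKernel {S : Set (α × α)} (hS : MeasurableSet S) (f : Lp ℂ 2 μ) :
    indicatorKernel μ hS f =ᵐ[μ] fun x => ∫ t in Prod.mk x ⁻¹' S, f t ∂μ :=
  (memLp_setIntegral_section hS f).coeFn_toLp

/-- Bessel's inequality for the sections of the kernel shows that the operator is
Hilbert–Schmidt. -/
theorem isCompactOperator_indicatorKernel {S : Set (α × α)} (hS : MeasurableSet S) :
    IsCompactOperator (indicatorKernel μ hS) := by
  obtain ⟨w, b, -⟩ := exists_hilbertBasis ℂ (Lp ℂ 2 μ)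
  refine isCompactOperator_of_summable_norm_sq b _
    (summable_of_sum_le (c := ∫ _, μ.real univ ∂μ) (fun _ => by positivity) fun F => ?_)
  have h1 : ∀ i, ‖indicatorKernel μ hS (b i)‖ ^ 2
      = ∫ x, ‖∫ t in Prod.mk x ⁻¹' S, b i t ∂μ‖ ^ 2 ∂μ := by
    intro i
    rw [L2.norm_sq_eq_integral]
    refine integral_congr_ae ?_
    filter_upwards [coeFn_indicatorKernel hS (b i)] with x hx
    rw [hx]
  have hi : ∀ i, Integrable (fun x => ‖∫ t in Prod.mk x ⁻¹' S, b i t ∂μ‖ ^ 2) μ := fun i =>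
    (memLp_setIntegral_section hS (b i)).norm.integrable_sq
  simp only [h1]
  rw [← integral_finsetSum _ fun i _ => hi i]
  refine integral_mono (integrable_finsetSum _ fun i _ => hi i) (integrable_const _) fun x => ?_
  simp only
  set k := indicatorConstLp (E := ℂ) 2 (measurable_prodMk_left hS : MeasurableSet
    (Prod.mk x ⁻¹' S)) (measure_ne_top μ _) 1 with hk
  have h2 : ∀ i, ‖∫ t in Prod.mk x ⁻¹' S, b i t ∂μ‖ ^ 2 = ‖⟪b i, k⟫_ℂ‖ ^ 2 := by
    intro i
    rw [← L2.inner_indicatorConstLp_one (measurable_prodMk_left hS) (measure_ne_top μ _),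
      norm_inner_symm]
  simp only [h2]
  refine (b.orthonormal.sum_inner_products_le k).trans ?_
  rw [hk, norm_indicatorConstLp (by norm_num) (by norm_num)]
  simp only [norm_one, one_mul, ENNReal.toReal_ofNat]
  rw [← Real.sqrt_eq_rpow, Real.sq_sqrt measureReal_nonneg]
  exact measureReal_mono (subset_univ _)

theorem inner_indicatorKernel {S : Set (α × α)} (hS : MeasurableSet S) (f g : Lp ℂ 2 μ) :
    ⟪f, indicatorKernel μ hS g⟫_ℂ = ⟪indicatorKernel μ (measurable_swap hS) f, g⟫_ℂ := by
  have hint : Integrable (Function.uncurry fun x t =>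
      S.indicator (fun p : α × α => starRingEnd ℂ (f p.1) * g p.2) (x, t)) (μ.prod μ) := by
    refine Integrable.indicator ?_ hS
    exact Integrable.mul_prod (f := fun x => starRingEnd ℂ (f x)) (g := fun x => g x)
      (RCLike.conjCLE.toContinuousLinearMap.integrable_comp
        ((Lp.memLp f).integrable (by norm_num))) ((Lp.memLp g).integrable (by norm_num))
  calc ⟪f, indicatorKernel μ hS g⟫_ℂ
      = ∫ x, ∫ t, S.indicator (fun p : α × α => starRingEnd ℂ (f p.1) * g p.2) (x, t) ∂μ ∂μ := by
        rw [L2.inner_def]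
        refine integral_congr_ae ?_
        filter_upwards [coeFn_indicatorKernel hS g] with x hx
        rw [hx, RCLike.inner_apply, mul_comm, ← integral_const_mul,
          ← integral_indicator (measurable_prodMk_left hS)]
        rfl
    _ = ∫ t, ∫ x, S.indicator (fun p : α × α => starRingEnd ℂ (f p.1) * g p.2) (x, t) ∂μ ∂μ :=
        integral_integral_swap hint
    _ = _ := by
        rw [L2.inner_def]
        refine integral_congr_ae ?_
        filter_upwards [coeFn_indicatorKernel (measurable_swap hS) f] with x hx
        rw [hx, RCLike.inner_apply, mul_comm, ← integral_conj, ← integral_mul_const,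
          ← integral_indicator (measurable_prodMk_left (measurable_swap hS))]
        rfl

theorem adjoint_indicatorKernel {S : Set (α × α)} (hS : MeasurableSet S) :
    ContinuousLinearMap.adjoint (indicatorKernel μ hS) = indicatorKernel μ (measurable_swap hS) :=
  ((ContinuousLinearMap.eq_adjoint_iff _ _).mpr fun f g => (inner_indicatorKernel hS f g).symm).symm

end IndicatorKernel

/-! ### The Dirichlet Laplacian as the inverse of an operator `-T†T` -/

section DirichletLaplacian

theorem measurableSet_snd_lt_fst : MeasurableSet {p : ℝ × ℝ | p.2 < p.1} :=
  measurableSet_lt measurable_snd measurable_fst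

variable (a b : ℝ)

/-- The Volterra operator `f ↦ ∫_a^x f` on `L²(]a, b[)`. -/
noncomputable def volterra : L2Interval a b →L[ℂ] L2Interval a b :=
  indicatorKernel _ measurableSet_snd_lt_fst

/-- The constant function `1` on `]a, b[`. -/
noncomputable def oneL2 : L2Interval a b :=
  indicatorConstLp 2 MeasurableSet.univ (measure_ne_top _ _) (1 : ℂ)

/-- The operator `f ↦ ∫_x^b f - m`, where the constant `m` makes the mean of the result vanish. The
Dirichlet Laplacian is the inverse of `-T†T`. -/
noncomputable def dirichletFactor : L2Interval a b →L[ℂ] L2Interval a b :=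
  (ℂ ∙ oneL2 a b)ᗮ.starProjection ∘L ContinuousLinearMap.adjoint (volterra a b)

variable {a b}

theorem L2Interval.setIntegral_Iio (f : L2Interval a b) {x : ℝ} (hx : x ∈ Ioo a b) :
    ∫ t in Iio x, f t ∂(volume.restrict (Ioo a b)) = ∫ t in a..x, f t := by
  rw [Measure.restrict_restrict measurableSet_Iio, intervalIntegral.integral_of_le hx.1.le,
    integral_Ioc_eq_integral_Ioo]
  congr 2
  ext t
  simp only [mem_inter_iff, mem_Iio, mem_Ioo]
  exact ⟨fun h => ⟨h.2.1, h.1⟩, fun h => ⟨h.2, h.1, h.2.trans hx.2⟩⟩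

theorem L2Interval.setIntegral_Ioi (f : L2Interval a b) {x : ℝ} (hx : x ∈ Ioo a b) :
    ∫ t in Ioi x, f t ∂(volume.restrict (Ioo a b)) = ∫ t in x..b, f t := by
  rw [Measure.restrict_restrict measurableSet_Ioi, intervalIntegral.integral_of_le hx.2.le,
    integral_Ioc_eq_integral_Ioo]
  congr 2
  ext t
  simp only [mem_inter_iff, mem_Ioi, mem_Ioo]
  exact ⟨fun h => ⟨h.1, h.2.2⟩, fun h => ⟨h.1, hx.1.trans h.1, h.2⟩⟩

theorem coeFn_volterra (f : L2Interval a b) :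
    volterra a b f =ᵐ[volume.restrict (Ioo a b)] fun x => ∫ t in a..x, f t := by
  filter_upwards [coeFn_indicatorKernel measurableSet_snd_lt_fst f,
    ae_restrict_mem measurableSet_Ioo] with x hx hxm
  rw [volterra, hx, ← L2Interval.setIntegral_Iio f hxm]
  rfl

theorem coeFn_adjoint_volterra (f : L2Interval a b) :
    ContinuousLinearMap.adjoint (volterra a b) f =ᵐ[volume.restrict (Ioo a b)]
      fun x => ∫ t in x..b, f t := by
  filter_upwards [coeFn_indicatorKernel (measurable_swap measurableSet_snd_lt_fst) f,
    ae_restrict_mem measurableSet_Ioo] with x hx hxm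
  rw [volterra, adjoint_indicatorKernel, hx, ← L2Interval.setIntegral_Ioi f hxm]
  rfl

theorem isCompactOperator_dirichletFactor : IsCompactOperator (dirichletFactor a b) := by
  have h : IsCompactOperator (ContinuousLinearMap.adjoint (volterra a b)) := by
    rw [volterra, adjoint_indicatorKernel]
    exact isCompactOperator_indicatorKernel _
  exact h.clm_comp (ℂ ∙ oneL2 a b)ᗮ.starProjection

theorem adjoint_dirichletFactor_apply (g : L2Interval a b) :
    ContinuousLinearMap.adjoint (dirichletFactor a b) (dirichletFactor a b g) =
      volterra a b ((ℂ ∙ oneL2 a b)ᗮ.starProjection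
        (ContinuousLinearMap.adjoint (volterra a b) g)) := by
  have h : (ℂ ∙ oneL2 a b)ᗮ.starProjection ((ℂ ∙ oneL2 a b)ᗮ.starProjection
      (ContinuousLinearMap.adjoint (volterra a b) g)) = (ℂ ∙ oneL2 a b)ᗮ.starProjection
      (ContinuousLinearMap.adjoint (volterra a b) g) :=
    Submodule.starProjection_eq_self_iff.mpr (Submodule.starProjection_apply_mem _ _)
  rw [dirichletFactor, ContinuousLinearMap.adjoint_comp, ContinuousLinearMap.adjoint_adjoint,
    (isSelfAdjoint_starProjection _).adjoint_eq]
  simp only [ContinuousLinearMap.comp_apply]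
  rw [h]

/-- A function with `v' = g` and mean zero is `-T g`, so that its primitive is `-T†T g`. -/
theorem coeFn_adjoint_dirichletFactor (hab : a < b) {g : L2Interval a b} {v : ℝ → ℂ}
    (hvc : ContinuousOn v (Icc a b)) (hv : ∀ x ∈ Icc a b, v x = v a + ∫ t in a..x, g t)
    (hmean : ∫ t in a..b, v t = 0) :
    ContinuousLinearMap.adjoint (dirichletFactor a b) (dirichletFactor a b (-g))
      =ᵐ[volume.restrict (Ioo a b)] fun x => ∫ t in a..x, v t := by
  have hvm : MemLp v 2 (volume.restrict (Ioo a b)) := by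
    obtain ⟨C, hC⟩ := isCompact_Icc.exists_bound_of_continuousOn hvc
    refine MemLp.of_bound ((hvc.mono Ioo_subset_Icc_self).aestronglyMeasurable measurableSet_Ioo)
      C ?_
    filter_upwards [ae_restrict_mem measurableSet_Ioo] with x hx
    exact hC x (Ioo_subset_Icc_self hx)
  set w : L2Interval a b := hvm.toLp v with hw
  have hwv : w =ᵐ[volume.restrict (Ioo a b)] v := hvm.coeFn_toLp
  have hone : oneL2 a b =ᵐ[volume.restrict (Ioo a b)] fun _ => (1 : ℂ) := by
    filter_upwards [indicatorConstLp_coeFn (p := 2) (hs := MeasurableSet.univ)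
      (hμs := measure_ne_top (volume.restrict (Ioo a b)) univ) (c := (1 : ℂ))] with x hx
    rw [oneL2, hx]
    simp
  have horth : w ∈ (ℂ ∙ oneL2 a b)ᗮ := by
    rw [Submodule.mem_orthogonal_singleton_iff_inner_right, oneL2,
      L2.inner_indicatorConstLp_one, Measure.restrict_univ, integral_congr_ae hwv,
      ← integral_Ioc_eq_integral_Ioo, ← intervalIntegral.integral_of_le hab.le, hmean]
  have hdec : ContinuousLinearMap.adjoint (volterra a b) (-g) = w - v b • oneL2 a b := by
    apply Lp.ext
    rw [map_neg]
    filter_upwards [coeFn_adjoint_volterra g, hwv, hone, ae_restrict_mem measurableSet_Ioo,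
      Lp.coeFn_sub w (v b • oneL2 a b), Lp.coeFn_smul (v b) (oneL2 a b),
      Lp.coeFn_neg (ContinuousLinearMap.adjoint (volterra a b) g)] with x h1 h2 h3 hx h4 h5 h6
    rw [h6, h4, Pi.neg_apply, Pi.sub_apply, h5, Pi.smul_apply, h1, h2, h3,
      hv b (right_mem_Icc.mpr hab.le), hv x (Ioo_subset_Icc_self hx),
      ← intervalIntegral.integral_interval_sub_left
        (g.intervalIntegrable (right_mem_Icc.mpr hab.le))
        (g.intervalIntegrable (Ioo_subset_Icc_self hx)), smul_eq_mul, mul_one]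
    ring
  rw [adjoint_dirichletFactor_apply, hdec, map_sub,
    Submodule.starProjection_eq_self_iff.mpr horth, Submodule.starProjection_orthogonal_apply_eq_zero
      (Submodule.smul_mem _ _ (Submodule.mem_span_singleton_self _)), sub_zero]
  filter_upwards [coeFn_volterra w, ae_restrict_mem measurableSet_Ioo] with x h1 hx
  rw [h1]
  exact L2Interval.integral_congr hwv (Ioo_subset_Icc_self hx)

theorem isDirichletLaplacian_iff (hab : a < b) {f g : L2Interval a b} :
    IsDirichletLaplacian a b f g ↔
      ContinuousLinearMap.adjoint (dirichletFactor a b) (dirichletFactor a b (-g)) = f := by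
  have hcont : ∀ c : ℂ, ContinuousOn (fun x => c + ∫ t in a..x, g t) (Icc a b) := by
    intro c
    have := intervalIntegral.continuousOn_primitive_interval'
      (g.intervalIntegrable (right_mem_Icc.mpr hab.le)) left_mem_uIcc
    rw [uIcc_of_le hab.le] at this
    exact continuousOn_const.add this
  constructor
  · rintro ⟨u, v, hu, hd, hv, ha, hb⟩
    have hvc : ContinuousOn v (Icc a b) := (hcont (v a)).congr hv
    have hprim : ∀ x ∈ Icc a b, ∫ t in a..x, v t = u x := by
      intro x hx
      have hsub : Icc a x ⊆ Icc a b := Icc_subset_Icc_right hx.2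
      have hint : IntervalIntegrable v volume a x := by
        refine ContinuousOn.intervalIntegrable ?_
        rw [uIcc_of_le hx.1]
        exact hvc.mono hsub
      rw [intervalIntegral.integral_eq_sub_of_hasDerivAt_of_le hx.1
        (fun y hy => (hd y (hsub hy)).continuousWithinAt.mono hsub)
        (fun y hy => (hd y (hsub (Ioo_subset_Icc_self hy))).hasDerivAt
          (Icc_mem_nhds hy.1 (hy.2.trans_le hx.2))) hint, ha, sub_zero]
    apply Lp.ext
    filter_upwards [hu, ae_restrict_mem measurableSet_Ioo, coeFn_adjoint_dirichletFactor hab hvc hv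
      (by rw [hprim b (right_mem_Icc.mpr hab.le), hb])] with x h1 hx h2
    rw [h1, h2, hprim x (Ioo_subset_Icc_self hx)]
  · intro hf
    -- the constant of integration that makes the mean of the derivative vanish
    set c : ℂ := -((b - a : ℝ) : ℂ)⁻¹ * ∫ x in a..b, ∫ t in a..x, g t with hc
    set v : ℝ → ℂ := fun x => c + ∫ t in a..x, g t with hvdef
    have hvc : ContinuousOn v (Icc a b) := hcont c
    have hva : ∀ x ∈ Icc a b, v x = v a + ∫ t in a..x, g t := by
      intro x _
      simp [hvdef]
    have hmean : ∫ t in a..b, v t = 0 := by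
      have h0 := hcont 0
      simp only [zero_add] at h0
      have hne : ((b - a : ℝ) : ℂ) ≠ 0 := by
        exact_mod_cast (sub_pos.mpr hab).ne'
      rw [hvdef, intervalIntegral.integral_add intervalIntegrable_const
        (ContinuousOn.intervalIntegrable (by rwa [uIcc_of_le hab.le])),
        intervalIntegral.integral_const, hc, Complex.real_smul]
      field_simp
      ring
    have hae := coeFn_adjoint_dirichletFactor hab hvc hva hmean
    rw [hf] at hae
    refine ⟨fun x => ∫ t in a..x, v t, v, hae, fun x hx => ?_, hva, by simp, hmean⟩
    have : Fact (x ∈ Icc a b) := ⟨hx⟩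
    refine intervalIntegral.integral_hasDerivWithinAt_right (t := Icc a b) ?_ ?_ (hvc x hx)
    · refine ContinuousOn.intervalIntegrable ?_
      rw [uIcc_of_le hx.1]
      exact hvc.mono (Icc_subset_Icc_right hx.2)
    · exact hvc.stronglyMeasurableAtFilter_nhdsWithin measurableSet_Icc x

end DirichletLaplacian

/-! ### Self-adjointness and semiboundedness of the Schrödinger operator -/

section Schrodinger

variable {a b : ℝ} (V : Lp ℝ ∞ (volume : Measure ℝ))

theorem ae_abs_le_norm : ∀ᵐ x, |V x| ≤ ‖V‖ := by
  have h := ae_le_eLpNormEssSup (f := V) (μ := volume)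
  filter_upwards [h] with x hx
  rw [Lp.norm_def, eLpNorm_exponent_top, ← Real.norm_eq_abs, ← toReal_enorm]
  refine ENNReal.toReal_mono ?_ hx
  have := Lp.eLpNorm_ne_top V
  rwa [eLpNorm_exponent_top] at this

theorem inner_potentialOperator (f : L2Interval a b) :
    ⟪f, potentialOperator V a b f⟫_ℂ =
      ((∫ x in Ioo a b, V x * ‖f x‖ ^ 2 : ℝ) : ℂ) := by
  rw [L2.inner_def, ← integral_complex_ofReal]
  refine integral_congr_ae ?_
  filter_upwards [coeFn_potentialOperator V a b f] with x hx
  rw [hx, RCLike.inner_apply, mul_assoc, RCLike.mul_conj]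
  push_cast
  rfl

theorem norm_potentialOperator_le (f : L2Interval a b) :
    ‖potentialOperator V a b f‖ ≤ ‖V‖ * ‖f‖ := by
  refine Lp.norm_le_mul_norm_of_ae_le_mul ?_
  filter_upwards [coeFn_potentialOperator V a b f, ae_restrict_of_ae (ae_abs_le_norm V)]
    with x h1 h2
  rw [h1, norm_mul, Complex.norm_real, Real.norm_eq_abs]
  gcongr

theorem integrable_potential_mul_norm_sq (f : L2Interval a b) :
    IntegrableOn (fun x => V x * ‖f x‖ ^ 2) (Ioo a b) := by
  refine (Lp.memLp f).norm.integrable_sq.bdd_mul (c := ‖V‖)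
    (Lp.aestronglyMeasurable V).restrict ?_
  filter_upwards [ae_restrict_of_ae (ae_abs_le_norm V)] with x hx using hx

theorem neg_norm_mul_le_integral_potential (f : L2Interval a b) :
    -‖V‖ * ‖f‖ ^ 2 ≤ ∫ x in Ioo a b, V x * ‖f x‖ ^ 2 := by
  rw [L2.norm_sq_eq_integral, ← integral_const_mul]
  refine integral_mono_ae ((Lp.memLp f).norm.integrable_sq.const_mul _)
    (integrable_potential_mul_norm_sq V f) ?_
  filter_upwards [ae_restrict_of_ae (ae_abs_le_norm V)] with x hx
  have := (abs_le.mp hx).1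
  gcongr

/-- The bounded nonnegative operator of multiplication by `V + ‖V‖`. -/
noncomputable def shiftedPotential (a b : ℝ) : L2Interval a b →L[ℂ] L2Interval a b :=
  (potentialOperator V a b).mkContinuous ‖V‖ (norm_potentialOperator_le V) +
    ((‖V‖ : ℝ) : ℂ) • ContinuousLinearMap.id ℂ _

theorem shiftedPotential_apply (f : L2Interval a b) :
    shiftedPotential V a b f = potentialOperator V a b f + ((‖V‖ : ℝ) : ℂ) • f :=
  rfl

theorem isPositive_shiftedPotential : (shiftedPotential V a b).IsPositive := by
  have key : ∀ f : L2Interval a b, ⟪f, shiftedPotential V a b f⟫_ℂ =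
      ((∫ x in Ioo a b, V x * ‖f x‖ ^ 2) + ‖V‖ * ‖f‖ ^ 2 : ℝ) := by
    intro f
    rw [shiftedPotential_apply, inner_add_right, inner_potentialOperator, inner_smul_right,
      inner_self_eq_norm_sq_to_K]
    push_cast
    rfl
  rw [ContinuousLinearMap.isPositive_iff_complex]
  intro f
  rw [← inner_conj_symm, key, Complex.conj_ofReal]
  refine ⟨by rw [RCLike.re_eq_complex_re, Complex.ofReal_re], ?_⟩
  have := neg_norm_mul_le_integral_potential V f
  rw [RCLike.re_eq_complex_re, Complex.ofReal_re]
  linarith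

theorem mem_graph_dirichletSchrodinger_iff {ψ φ : L2Interval a b} :
    (ψ, φ) ∈ (dirichletSchrodinger V a b).graph ↔
      IsDirichletLaplacian a b ψ (potentialOperator V a b ψ - φ) := by
  rw [← mem_graph_dirichletLaplacian_iff, LinearPMap.mem_graph_iff, LinearPMap.mem_graph_iff]
  constructor
  · rintro ⟨y, hy, h⟩
    refine ⟨y, hy, ?_⟩
    simp only at hy h
    rw [← h, ← hy]
    change _ = potentialOperator V a b y - (potentialOperator V a b y + -dirichletLaplacian a b y)
    abel
  · rintro ⟨y, hy, h⟩
    refine ⟨y, hy, ?_⟩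
    simp only at hy h
    change potentialOperator V a b y + -dirichletLaplacian a b y = φ
    rw [h, ← hy]
    abel

theorem exists_isSpectralMeasure_dirichletSchrodinger (hab : a < b) :
    ∃ P : ProjectionValuedMeasure (L2Interval a b),
      IsSpectralMeasure (dirichletSchrodinger V a b) P := by
  refine exists_isSpectralMeasure_of_isCompactOperator (T := dirichletFactor a b)
    isCompactOperator_dirichletFactor (isPositive_shiftedPotential V) ‖V‖ fun ψ φ => ?_
  rw [mem_graph_dirichletSchrodinger_iff, isDirichletLaplacian_iff hab, shiftedPotential_apply,
    neg_sub, add_sub_add_right_eq_sub]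

theorem neg_norm_mul_le_inner_dirichletSchrodinger (hab : a < b)
    (ψ : (dirichletSchrodinger V a b).domain) :
    -‖V‖ * ‖(ψ : L2Interval a b)‖ ^ 2 ≤
      (⟪(ψ : L2Interval a b), dirichletSchrodinger V a b ψ⟫_ℂ).re := by
  have h := (isDirichletLaplacian_iff hab).mp
    ((mem_graph_dirichletSchrodinger_iff V).mp ((dirichletSchrodinger V a b).mem_graph ψ))
  set ψ' : L2Interval a b := ψ.1
  set χ := -(potentialOperator V a b ψ' - dirichletSchrodinger V a b ψ) with hχ
  have h1 : dirichletSchrodinger V a b ψ = potentialOperator V a b ψ' + χ := by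
    rw [hχ]; abel
  have h2 : ⟪ψ', χ⟫_ℂ = ((‖dirichletFactor a b χ‖ ^ 2 : ℝ) : ℂ) := by
    rw [← h, ContinuousLinearMap.adjoint_inner_left, inner_self_eq_norm_sq_to_K]
    push_cast
    rfl
  rw [h1, inner_add_right (𝕜 := ℂ) ψ', h2, inner_potentialOperator, Complex.add_re, Complex.ofReal_re,
    Complex.ofReal_re]
  nlinarith [neg_norm_mul_le_integral_potential V ψ', sq_nonneg ‖dirichletFactor a b χ‖]

end Schrodinger

/-! ### Solutions with vanishing Cauchy data -/

section CauchyData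

/-- Gronwall's inequality in integral form. -/
theorem le_mul_exp_of_le_add_mul_integral {w : ℝ → ℝ} {c d A K : ℝ} (hw : ContinuousOn w (Icc c d))
    (hw0 : ∀ x ∈ Icc c d, 0 ≤ w x) (hA : 0 ≤ A) (hK : 0 ≤ K)
    (h : ∀ x ∈ Icc c d, w x ≤ A + K * ∫ t in c..x, w t) {x : ℝ} (hx : x ∈ Icc c d) :
    w x ≤ A * Real.exp (K * (x - c)) := by
  have hcd : c ≤ d := hx.1.trans hx.2
  have hint : IntervalIntegrable w volume c d :=
    ContinuousOn.intervalIntegrable (by rwa [uIcc_of_le hcd])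
  have hG0 : ∀ y ∈ Icc c d, 0 ≤ A + K * ∫ t in c..y, w t := fun y hy =>
    (hw0 y hy).trans (h y hy)
  have hc : ContinuousOn (fun y => A + K * ∫ t in c..y, w t) (Icc c d) := by
    have := intervalIntegral.continuousOn_primitive_interval' hint left_mem_uIcc
    rw [uIcc_of_le hcd] at this
    exact continuousOn_const.add (continuousOn_const.mul this)
  have hd : ∀ y ∈ Ico c d,
      HasDerivWithinAt (fun y => A + K * ∫ t in c..y, w t) (K * w y) (Ici y) y := by
    intro y hy
    have hy' : y ∈ Icc c d := Ico_subset_Icc_self hy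
    have h1 : HasDerivWithinAt (fun z => ∫ t in c..z, w t) (w y) (Ici y) y := by
      refine intervalIntegral.integral_hasDerivWithinAt_right (t := Ioi y) ?_ ?_ ?_
      · refine ContinuousOn.intervalIntegrable ?_
        rw [uIcc_of_le hy.1]
        exact hw.mono (Icc_subset_Icc_right hy.2.le)
      · refine ⟨Ioc y d, Ioc_mem_nhdsGT hy.2, ?_⟩
        exact (hw.mono (Ioc_subset_Icc_self.trans (Icc_subset_Icc_left hy.1))).aestronglyMeasurable
          measurableSet_Ioc
      · refine ((hw y hy').mono_of_mem_nhdsWithin ?_)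
        exact Filter.mem_of_superset (Ioc_mem_nhdsGT hy.2)
          (Ioc_subset_Icc_self.trans (Icc_subset_Icc_left hy.1))
    exact (h1.const_mul K).const_add A
  have := norm_le_gronwallBound_of_norm_deriv_right_le (δ := A) (K := K) (ε := 0) hc hd
    (by simp [abs_of_nonneg hA]) (fun y hy => by
      have hy' : y ∈ Icc c d := Ico_subset_Icc_self hy
      rw [add_zero, norm_mul, Real.norm_of_nonneg hK, Real.norm_of_nonneg (hw0 y hy'),
        Real.norm_of_nonneg (hG0 y hy')]
      exact mul_le_mul_of_nonneg_left (h y hy') hK) x hx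
  rw [Real.norm_of_nonneg (hG0 x hx), gronwallBound_ε0] at this
  exact (h x hx).trans this

theorem sq_integral_le_measureReal_mul_integral_sq {α : Type*} [MeasurableSpace α] {μ : Measure α}
    [IsFiniteMeasure μ] {f : α → ℝ} (hf : MemLp f 2 μ) :
    (∫ x, f x ∂μ) ^ 2 ≤ μ.real univ * ∫ x, f x ^ 2 ∂μ := by
  have hi : Integrable f μ := hf.integrable (by norm_num)
  set M := μ.real univ with hM
  set I := ∫ x, f x ∂μ with hI
  -- the variance of `f` is nonnegative
  have h0 : 0 ≤ ∫ x, (M * f x - I) ^ 2 ∂μ := integral_nonneg fun x => sq_nonneg _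
  have h1 : ∫ x, (M * f x - I) ^ 2 ∂μ = M * (M * (∫ x, f x ^ 2 ∂μ) - I ^ 2) := by
    have : ∀ x, (M * f x - I) ^ 2 = M ^ 2 * f x ^ 2 - 2 * M * I * f x + I ^ 2 := fun x => by ring
    have e1 : Integrable (fun x => M ^ 2 * f x ^ 2) μ := hf.integrable_sq.const_mul _
    have e2 : Integrable (fun x => 2 * M * I * f x) μ := hi.const_mul _
    have e3 : Integrable (fun x => M ^ 2 * f x ^ 2 - 2 * M * I * f x) μ := e1.sub e2
    simp only [this]
    rw [integral_add e3 (integrable_const _), integral_sub e1 e2, integral_const_mul,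
      integral_const_mul, integral_const, smul_eq_mul, ← hM, ← hI]
    ring
  rcases eq_or_lt_of_le (measureReal_nonneg : 0 ≤ μ.real univ) with hM0 | hM0
  · have hμ : μ = 0 := by
      rw [eq_comm, measureReal_eq_zero_iff] at hM0
      exact Measure.measure_univ_eq_zero.mp hM0
    simp [hI, hμ]
  · rw [h1] at h0
    linarith [nonneg_of_mul_nonneg_right h0 hM0]

variable {a b : ℝ}

/-- If `u` and `u'` vanish at `c`, then `u` is controlled on `[c, d]` by the inhomogeneity `ζ` of the
differential inequality `|u''| ≤ K |u| + |ζ|`. -/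
theorem integral_norm_sq_le_of_cauchyData_eq_zero {g ζ : L2Interval a b} {u v : ℝ → ℂ}
    (hu : ∀ x ∈ Icc a b, HasDerivWithinAt u (v x) (Icc a b) x)
    (hv : ∀ x ∈ Icc a b, v x = v a + ∫ t in a..x, g t)
    {K : ℝ} (hK : 1 ≤ K)
    (hg : ∀ᵐ x ∂(volume.restrict (Ioo a b)), ‖g x‖ ≤ K * ‖u x‖ + ‖ζ x‖)
    {c d : ℝ} (hac : a ≤ c) (hcd : c ≤ d) (hdb : d ≤ b) (huc : u c = 0) (hvc : v c = 0) :
    ∫ x in c..d, ‖u x‖ ^ 2 ≤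
      ((d - c) * Real.exp (K * (d - c))) ^ 2 * ∫ x in c..d, ‖ζ x‖ ^ 2 := by
  have hsub : Icc c d ⊆ Icc a b := Icc_subset_Icc hac hdb
  have hsubo : Ioo c d ⊆ Ioo a b := Ioo_subset_Ioo hac hdb
  have hca : c ∈ Icc a b := ⟨hac, hcd.trans hdb⟩
  have hab : a ≤ b := hac.trans (hcd.trans hdb)
  have hgi : ∀ x ∈ Icc c d, IntervalIntegrable g volume c x := fun x hx =>
    (g.intervalIntegrable hca).symm.trans (g.intervalIntegrable (hsub hx))
  have hζi : ∀ x ∈ Icc c d, IntervalIntegrable ζ volume c x := fun x hx =>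
    (ζ.intervalIntegrable hca).symm.trans (ζ.intervalIntegrable (hsub hx))
  have hucont : ContinuousOn u (Icc c d) := fun x hx =>
    (hu x (hsub hx)).continuousWithinAt.mono hsub
  have hvx : ∀ x ∈ Icc c d, v x = ∫ t in c..x, g t := by
    intro x hx
    rw [← intervalIntegral.integral_interval_sub_left (g.intervalIntegrable (hsub hx))
      (g.intervalIntegrable hca)]
    have h1 := hv x (hsub hx)
    have h2 := hv c hca
    rw [hvc] at h2
    rw [h1]
    linear_combination -h2
  have hvcont : ContinuousOn v (Icc c d) := by
    have := intervalIntegral.continuousOn_primitive_interval' (hgi d (right_mem_Icc.mpr hcd))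
      left_mem_uIcc
    rw [uIcc_of_le hcd] at this
    exact this.congr hvx
  have hii : ∀ {E : Type} [NormedAddCommGroup E] {f : ℝ → E}, ContinuousOn f (Icc c d) →
      ∀ x ∈ Icc c d, IntervalIntegrable f volume c x := by
    intro E _ f hf x hx
    refine ContinuousOn.intervalIntegrable ?_
    rw [uIcc_of_le hx.1]
    exact hf.mono (Icc_subset_Icc_right hx.2)
  have hux : ∀ x ∈ Icc c d, u x = ∫ t in c..x, v t := by
    intro x hx
    have hs : Icc c x ⊆ Icc c d := Icc_subset_Icc_right hx.2
    rw [intervalIntegral.integral_eq_sub_of_hasDerivAt_of_le hx.1 (hucont.mono hs)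
      (fun y hy => (hu y (hsub (hs (Ioo_subset_Icc_self hy)))).hasDerivAt
        (Icc_mem_nhds (hac.trans_lt hy.1) (hy.2.trans_le (hx.2.trans hdb)))) (hii hvcont x hx),
      huc, sub_zero]
  set A : ℝ := ∫ t in c..d, ‖ζ t‖ with hA
  have hA0 : 0 ≤ A := intervalIntegral.integral_nonneg hcd fun _ _ => norm_nonneg _
  have hw : ∀ x ∈ Icc c d, ‖u x‖ + ‖v x‖ ≤ A + K * ∫ t in c..x, (‖u t‖ + ‖v t‖) := by
    intro x hx
    have h1 : ‖u x‖ ≤ ∫ t in c..x, ‖v t‖ := by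
      rw [hux x hx]
      exact intervalIntegral.norm_integral_le_integral_norm hx.1
    have h2 : ‖v x‖ ≤ ∫ t in c..x, (K * ‖u t‖ + ‖ζ t‖) := by
      rw [hvx x hx]
      refine intervalIntegral.norm_integral_le_of_norm_le hx.1 ?_
        (((hii hucont.norm x hx).const_mul K).add (hζi x hx).norm)
      rw [← ae_restrict_iff' measurableSet_Ioc, ← Measure.restrict_congr_set Ioo_ae_eq_Ioc]
      exact ae_restrict_of_ae_restrict_of_subset
        (Ioo_subset_Ioo hac (hx.2.trans hdb)) hg
    have h3 : ∫ t in c..x, ‖ζ t‖ ≤ A :=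
      intervalIntegral.integral_mono_interval le_rfl hx.1 hx.2
        (Filter.Eventually.of_forall fun _ => norm_nonneg _)
        (hζi d (right_mem_Icc.mpr hcd)).norm
    have h4 : 0 ≤ ∫ t in c..x, ‖v t‖ :=
      intervalIntegral.integral_nonneg hx.1 fun _ _ => norm_nonneg _
    rw [intervalIntegral.integral_add ((hii hucont.norm x hx).const_mul K) (hζi x hx).norm,
      intervalIntegral.integral_const_mul] at h2
    rw [intervalIntegral.integral_add (hii hucont.norm x hx) (hii hvcont.norm x hx)]
    nlinarith
  have hbound : ∀ x ∈ Icc c d, ‖u x‖ ≤ A * Real.exp (K * (d - c)) := by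
    intro x hx
    have := le_mul_exp_of_le_add_mul_integral (hucont.norm.add hvcont.norm)
      (fun y _ => add_nonneg (norm_nonneg _) (norm_nonneg _)) hA0 (zero_le_one.trans hK) hw hx
    calc ‖u x‖ ≤ ‖u x‖ + ‖v x‖ := by linarith [norm_nonneg (v x)]
      _ ≤ _ := this
      _ ≤ _ := by
        gcongr
        exact hx.2
  have hA2 : A ^ 2 ≤ (d - c) * ∫ x in c..d, ‖ζ x‖ ^ 2 := by
    have hm : MemLp (fun x => ‖ζ x‖) 2 (volume.restrict (Ioo c d)) :=
      ((Lp.memLp ζ).mono_measure (Measure.restrict_mono hsubo le_rfl)).norm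
    have := sq_integral_le_measureReal_mul_integral_sq hm
    rw [hA, intervalIntegral.integral_of_le hcd, intervalIntegral.integral_of_le hcd,
      integral_Ioc_eq_integral_Ioo, integral_Ioc_eq_integral_Ioo]
    simpa [Measure.real, hcd] using this
  calc ∫ x in c..d, ‖u x‖ ^ 2 ≤ ∫ _ in c..d, (A * Real.exp (K * (d - c))) ^ 2 := by
        refine intervalIntegral.integral_mono_on hcd
          (hii (hucont.norm.pow 2) d (right_mem_Icc.mpr hcd)) intervalIntegrable_const fun x hx => ?_
        exact pow_le_pow_left₀ (norm_nonneg _) (hbound x hx) 2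
    _ = A ^ 2 * ((d - c) * Real.exp (K * (d - c)) ^ 2) := by
        rw [intervalIntegral.integral_const, smul_eq_mul]
        ring
    _ ≤ ((d - c) * ∫ x in c..d, ‖ζ x‖ ^ 2) * ((d - c) * Real.exp (K * (d - c)) ^ 2) := by
        refine mul_le_mul_of_nonneg_right hA2 ?_
        have := sub_nonneg.mpr hcd
        positivity
    _ = _ := by ring

/-- The graph of the Dirichlet Laplacian together with representatives `u` and `v = u'`: the
quadruples `(f, g, u, v)` such that `u` and `v` witness that `g` is the Dirichlet Laplacian of
`f`. -/
def dirichletRepresentatives (a b : ℝ) :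
    Submodule ℂ (L2Interval a b × L2Interval a b × (ℝ → ℂ) × (ℝ → ℂ)) where
  carrier := {q | q.1 =ᵐ[volume.restrict (Ioo a b)] q.2.2.1 ∧
    (∀ x ∈ Icc a b, HasDerivWithinAt q.2.2.1 (q.2.2.2 x) (Icc a b) x) ∧
    (∀ x ∈ Icc a b, q.2.2.2 x = q.2.2.2 a + ∫ t in a..x, q.2.1 t)}
  zero_mem' := by
    refine ⟨Lp.coeFn_zero _ _ _, fun x _ => hasDerivWithinAt_const x _ 0, fun x hx => ?_⟩
    simp only [Prod.snd_zero, Prod.fst_zero]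
    rw [L2Interval.integral_congr (Lp.coeFn_zero ℂ 2 _) hx]
    simp
  add_mem' := by
    rintro ⟨f, g, u, v⟩ ⟨f', g', u', v'⟩ ⟨h1, h2, h3⟩ ⟨h1', h2', h3'⟩
    refine ⟨(Lp.coeFn_add f f').trans (h1.add h1'), fun x hx => (h2 x hx).add (h2' x hx),
      fun x hx => ?_⟩
    simp only [Prod.snd_add, Prod.fst_add, Pi.add_apply] at *
    rw [L2Interval.integral_congr (Lp.coeFn_add g g') hx, h3 x hx, h3' x hx]
    simp only [Pi.add_apply]
    rw [intervalIntegral.integral_add (g.intervalIntegrable hx) (g'.intervalIntegrable hx)]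
    ring
  smul_mem' := by
    rintro c ⟨f, g, u, v⟩ ⟨h1, h2, h3⟩
    refine ⟨(Lp.coeFn_smul c f).trans (h1.const_smul c), fun x hx => (h2 x hx).const_smul c,
      fun x hx => ?_⟩
    simp only [Prod.smul_snd, Prod.smul_fst, Pi.smul_apply] at *
    rw [L2Interval.integral_congr (Lp.coeFn_smul c g) hx, h3 x hx]
    simp only [Pi.smul_apply]
    rw [intervalIntegral.integral_smul, smul_add]

theorem L2Interval.norm_sq_eq_intervalIntegral (hab : a ≤ b) (f : L2Interval a b) :
    ‖f‖ ^ 2 = ∫ x in a..b, ‖f x‖ ^ 2 := by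
  rw [L2.norm_sq_eq_integral, intervalIntegral.integral_of_le hab, integral_Ioc_eq_integral_Ioo]

/-- If the Cauchy data of `u` vanish at the left end of each of `n` cells of length `δ` that
partition the interval, then `u` is controlled by the inhomogeneity. -/
theorem norm_le_of_cauchyData_eq_zero {f g ζ : L2Interval a b} {u v : ℝ → ℂ}
    (hq : (f, g, u, v) ∈ dirichletRepresentatives a b) {K : ℝ} (hK : 1 ≤ K)
    (hg : ∀ᵐ x ∂(volume.restrict (Ioo a b)), ‖g x‖ ≤ K * ‖f x‖ + ‖ζ x‖)
    {n : ℕ} {δ : ℝ} (hδ : 0 ≤ δ) (hn : a + n * δ = b)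
    (hu0 : ∀ j < n, u (a + j * δ) = 0) (hv0 : ∀ j < n, v (a + j * δ) = 0) :
    ‖f‖ ≤ δ * Real.exp (K * δ) * ‖ζ‖ := by
  obtain ⟨hfu, hu, hv⟩ := hq
  simp only at hfu hu hv
  have hab : a ≤ b := by rw [← hn]; linarith [mul_nonneg n.cast_nonneg hδ]
  have hg' : ∀ᵐ x ∂(volume.restrict (Ioo a b)), ‖g x‖ ≤ K * ‖u x‖ + ‖ζ x‖ := by
    filter_upwards [hg, hfu] with x h1 h2
    rwa [← h2]
  have hζi : IntervalIntegrable (fun x => ‖ζ x‖ ^ 2) volume a b := by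
    rw [intervalIntegrable_iff_integrableOn_Ioo_of_le hab]
    exact (Lp.memLp ζ).norm.integrable_sq
  have hucont : ContinuousOn u (Icc a b) := fun x hx => (hu x hx).continuousWithinAt
  have hui : IntervalIntegrable (fun x => ‖u x‖ ^ 2) volume a b := by
    refine ContinuousOn.intervalIntegrable ?_
    rw [uIcc_of_le hab]
    exact hucont.norm.pow 2
  have hmem : ∀ j ≤ n, a + j * δ ∈ Icc a b := by
    intro j hj
    have hj' : (j : ℝ) ≤ n := by exact_mod_cast hj
    exact ⟨by linarith [mul_nonneg j.cast_nonneg hδ],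
      by rw [← hn]; linarith [mul_le_mul_of_nonneg_right hj' hδ]⟩
  have hsubi : ∀ {F : ℝ → ℝ}, IntervalIntegrable F volume a b → ∀ j < n,
      IntervalIntegrable F volume (a + (j : ℕ) * δ) (a + ((j + 1 : ℕ)) * δ) := by
    intro F hF j hj
    refine hF.mono_set ?_
    rw [uIcc_of_le hab]
    exact uIcc_subset_Icc (hmem j hj.le) (hmem (j + 1) hj)
  have hsum : ∀ {F : ℝ → ℝ}, IntervalIntegrable F volume a b → ∫ x in a..b, F x =
      ∑ j ∈ Finset.range n, ∫ x in (a + (j : ℕ) * δ)..(a + ((j + 1 : ℕ)) * δ), F x := by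
    intro F hF
    rw [intervalIntegral.sum_integral_adjacent_intervals (a := fun j : ℕ => a + j * δ) (hsubi hF),
      Nat.cast_zero, zero_mul, add_zero, hn]
  have hsq : ‖f‖ ^ 2 ≤ (δ * Real.exp (K * δ) * ‖ζ‖) ^ 2 := by
    have h1 : ‖f‖ ^ 2 = ∫ x in a..b, ‖u x‖ ^ 2 := by
      rw [f.norm_sq_eq_intervalIntegral hab, intervalIntegral.integral_of_le hab,
        intervalIntegral.integral_of_le hab, integral_Ioc_eq_integral_Ioo,
        integral_Ioc_eq_integral_Ioo]
      refine integral_congr_ae ?_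
      filter_upwards [hfu] with x hx
      rw [hx]
    rw [h1, mul_pow, ζ.norm_sq_eq_intervalIntegral hab, hsum hui, hsum hζi, Finset.mul_sum]
    refine Finset.sum_le_sum fun j hj => ?_
    have hj' := Finset.mem_range.mp hj
    have hstep : a + ((j + 1 : ℕ) : ℝ) * δ - (a + (j : ℝ) * δ) = δ := by
      push_cast; ring
    have := integral_norm_sq_le_of_cauchyData_eq_zero hu hv hK hg' (hmem j hj'.le).1
      (by linarith) (hmem (j + 1) hj').2 (hu0 j hj') (hv0 j hj')
    rwa [hstep] at this
  exact le_of_sq_le_sq hsq (by positivity)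

end CauchyData

/-! ### The bound on the density of states -/

section DensityOfStates

variable {a b : ℝ} {V : Lp ℝ ∞ (volume : Measure ℝ)}
  {P : ProjectionValuedMeasure (L2Interval a b)}

theorem exists_mem_dirichletRepresentatives (ψ : (dirichletSchrodinger V a b).domain) :
    ∃ u v : ℝ → ℂ, ((ψ : L2Interval a b),
      potentialOperator V a b ψ - dirichletSchrodinger V a b ψ, u, v) ∈
        dirichletRepresentatives a b := by
  obtain ⟨u, v, h1, h2, h3, -, -⟩ := (mem_graph_dirichletSchrodinger_iff V).mp
    ((dirichletSchrodinger V a b).mem_graph ψ)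
  exact ⟨u, v, h1, h2, h3⟩

/-- An approximate eigenvector with vanishing Cauchy data at the left end of each cell of a fine
enough partition is zero. -/
theorem eq_zero_of_cauchyData_eq_zero (hP : IsSpectralMeasure (dirichletSchrodinger V a b) P)
    {E ε K δ : ℝ} {n : ℕ} (hε : 0 ≤ ε) (hK : 1 ≤ K) (hV : ‖V‖ + |E| ≤ K) (hδ : 0 ≤ δ)
    (hn : a + n * δ = b) (hsmall : δ * Real.exp (K * δ) * ε < 1)
    {ψ : (dirichletSchrodinger V a b).domain} (hψ : P.proj (Icc E (E + ε)) ψ = ψ) {u v : ℝ → ℂ}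
    (hq : ((ψ : L2Interval a b), potentialOperator V a b ψ - dirichletSchrodinger V a b ψ, u, v) ∈
      dirichletRepresentatives a b)
    (hu0 : ∀ j < n, u (a + j * δ) = 0) (hv0 : ∀ j < n, v (a + j * δ) = 0) :
    (ψ : L2Interval a b) = 0 := by
  set ζ : L2Interval a b := dirichletSchrodinger V a b ψ - (E : ℂ) • (ψ : L2Interval a b) with hζ
  have hg : ∀ᵐ x ∂(volume.restrict (Ioo a b)),
      ‖(potentialOperator V a b ψ - dirichletSchrodinger V a b ψ : L2Interval a b) x‖ ≤
        K * ‖(ψ : L2Interval a b) x‖ + ‖ζ x‖ := by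
    have hdec : potentialOperator V a b ψ - dirichletSchrodinger V a b ψ =
        potentialOperator V a b ψ - ((E : ℂ) • (ψ : L2Interval a b) + ζ) := by
      rw [hζ]; abel
    rw [hdec]
    filter_upwards [coeFn_potentialOperator V a b (ψ : L2Interval a b),
      ae_restrict_of_ae (ae_abs_le_norm V), Lp.coeFn_smul (E : ℂ) (ψ : L2Interval a b),
      Lp.coeFn_add ((E : ℂ) • (ψ : L2Interval a b)) ζ,
      Lp.coeFn_sub (potentialOperator V a b ψ) ((E : ℂ) • (ψ : L2Interval a b) + ζ)]
      with x h1 h2 h3 h4 h5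
    rw [h5, Pi.sub_apply, h4, Pi.add_apply, h3, Pi.smul_apply, h1, smul_eq_mul]
    set y := (ψ : L2Interval a b) x
    calc ‖(V x : ℂ) * y - (E * y + ζ x)‖ ≤ ‖(V x : ℂ) * y‖ + (‖(E : ℂ) * y‖ + ‖ζ x‖) :=
          (norm_sub_le _ _).trans (by gcongr; exact norm_add_le _ _)
      _ = (|V x| + |E|) * ‖y‖ + ‖ζ x‖ := by
          rw [norm_mul, norm_mul, Complex.norm_real, Complex.norm_real, Real.norm_eq_abs,
            Real.norm_eq_abs]
          ring
      _ ≤ K * ‖y‖ + ‖ζ x‖ := by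
          gcongr
          linarith
  have h1 := norm_le_of_cauchyData_eq_zero hq hK hg hδ hn hu0 hv0
  have h2 : ‖ζ‖ ≤ ε * ‖(ψ : L2Interval a b)‖ := hP.norm_sub_smul_le hε hψ
  have h3 : ‖(ψ : L2Interval a b)‖ ≤ δ * Real.exp (K * δ) * ε * ‖(ψ : L2Interval a b)‖ :=
    h1.trans ((mul_le_mul_of_nonneg_left h2 (by positivity)).trans_eq (by ring))
  by_contra h0
  have h4 : 0 < ‖(ψ : L2Interval a b)‖ := norm_pos_iff.mpr h0
  nlinarith

/-- The spectral subspace of `[E, E + ε]` has dimension at most `2n`: otherwise it contains a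
nonzero vector whose `2n` Cauchy data at the left ends of the cells all vanish. -/
theorem traceNonneg_proj_Icc_le (hP : IsSpectralMeasure (dirichletSchrodinger V a b) P)
    {E ε K δ : ℝ} {n : ℕ} (hε : 0 ≤ ε) (hK : 1 ≤ K) (hV : ‖V‖ + |E| ≤ K) (hδ : 0 ≤ δ)
    (hn : a + n * δ = b) (hsmall : δ * Real.exp (K * δ) * ε < 1) :
    traceNonneg (P.proj (Icc E (E + ε))) ≤ (n * 2 : ℕ) := by
  refine traceNonneg_le_of_linearIndependent (P.isStarProjection _ measurableSet_Icc)
    fun m w hw hli => ?_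
  by_contra! hm
  have hdom : ∀ k, w k ∈ (dirichletSchrodinger V a b).domain := fun k => by
    rw [← hw k]
    exact hP.proj_mem_domain_of_subset (R := max |E| |E + ε|) measurableSet_Icc
      (fun t ht => abs_le_max_abs_abs ht.1 ht.2) _
  choose u v hq using fun k => exists_mem_dirichletRepresentatives ⟨w k, hdom k⟩
  set q : Fin m → L2Interval a b × L2Interval a b × (ℝ → ℂ) × (ℝ → ℂ) := fun k =>
    (w k, potentialOperator V a b (w k) - dirichletSchrodinger V a b ⟨w k, hdom k⟩, u k, v k)
  let ev : (L2Interval a b × L2Interval a b × (ℝ → ℂ) × (ℝ → ℂ)) →ₗ[ℂ] (Fin n → ℂ × ℂ) :=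
    { toFun := fun p j => (p.2.2.1 (a + (j : ℕ) * δ), p.2.2.2 (a + (j : ℕ) * δ))
      map_add' := fun _ _ => rfl
      map_smul' := fun _ _ => rfl }
  obtain ⟨c, hc, hc0⟩ := Submodule.exists_mem_ne_zero_of_ne_bot
    (LinearMap.ker_ne_bot_of_finrank_lt (f := ev ∘ₗ Fintype.linearCombination ℂ q) (by
      simpa [Module.finrank_pi_fintype] using hm))
  set s := ∑ k, c k • q k with hs
  have hev : ev s = 0 := by
    rwa [LinearMap.mem_ker, LinearMap.comp_apply, Fintype.linearCombination_apply] at hc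
  have hmem : s ∈ dirichletRepresentatives a b :=
    Submodule.sum_mem _ fun k _ => Submodule.smul_mem _ _ (hq k)
  set ψ : (dirichletSchrodinger V a b).domain := ∑ k, c k • ⟨w k, hdom k⟩ with hψ
  have hψc : (ψ : L2Interval a b) = ∑ k, c k • w k := by
    rw [hψ, Submodule.coe_sum]
    rfl
  have hs1 : s.1 = (ψ : L2Interval a b) := by
    rw [hψc, hs, Prod.fst_sum]
    rfl
  have hs2 : s.2.1 = potentialOperator V a b ψ - dirichletSchrodinger V a b ψ := by
    have hA : dirichletSchrodinger V a b ψ =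
        ∑ k, c k • dirichletSchrodinger V a b ⟨w k, hdom k⟩ := by
      change (dirichletSchrodinger V a b).toFun ψ = _
      rw [hψ, map_sum]
      simp only [map_smul]
      rfl
    rw [hA, hψc, map_sum, ← Finset.sum_sub_distrib, hs, Prod.snd_sum, Prod.fst_sum]
    refine Finset.sum_congr rfl fun k _ => ?_
    rw [map_smul, ← smul_sub]
    rfl
  have hzero := eq_zero_of_cauchyData_eq_zero (u := s.2.2.1) (v := s.2.2.2) hP hε hK hV hδ hn hsmall
    (ψ := ψ)
    (by rw [hψc, map_sum]; simp only [map_smul, hw])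
    (by rw [← hs2, ← hs1]; exact hmem)
    (fun j hj => congrArg Prod.fst (congrFun hev ⟨j, hj⟩))
    (fun j hj => congrArg Prod.snd (congrFun hev ⟨j, hj⟩))
  rw [hψc] at hzero
  exact hc0 (funext (Fintype.linearIndependent_iff.mp hli c hzero))

theorem proj_Icc_eq_zero_of_lt (hab : a < b)
    (hP : IsSpectralMeasure (dirichletSchrodinger V a b) P) {E ε : ℝ} (hE : E + ε < -‖V‖) :
    P.proj (Icc E (E + ε)) = 0 := by
  ext1 ψ
  have hd : P.proj (Icc E (E + ε)) ψ ∈ (dirichletSchrodinger V a b).domain :=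
    hP.proj_mem_domain_of_subset (R := max |E| |E + ε|) measurableSet_Icc
      (fun t ht => abs_le_max_abs_abs ht.1 ht.2) _
  have h1 := (hP.re_inner_mem_Icc (x := ⟨_, hd⟩) (P.proj_proj measurableSet_Icc ψ)).2
  have h2 := (neg_norm_mul_le_inner_dirichletSchrodinger V hab ⟨_, hd⟩).trans h1
  by_contra h0
  have h3 : 0 < ‖P.proj (Icc E (E + ε)) ψ‖ := norm_pos_iff.mpr h0
  simp only at h2
  nlinarith [pow_pos h3 2]

end DensityOfStates

theorem theorem2p3 (E₀ Vinf : ℝ) :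
    ∃ L₀ C : ℝ, 0 < L₀ ∧ 0 < C ∧
      ∀ V : Lp ℝ ∞ (volume : Measure ℝ), ‖V‖ = Vinf →
      ∀ ε : ℝ, 0 < ε → ε ≤ 1 / 2 →
      ∀ a b : ℝ, a < b → L₀ * Real.log (1 / ε) ≤ b - a →
        (∃ P : ProjectionValuedMeasure (L2Interval a b),
          IsSpectralMeasure (dirichletSchrodinger V a b) P) ∧
        ∀ P : ProjectionValuedMeasure (L2Interval a b),
          IsSpectralMeasure (dirichletSchrodinger V a b) P →
          ∀ E : ℝ, E ≤ E₀ →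
            densityOfStates P (Icc E (E + ε)) ≤ ENNReal.ofReal (C / Real.log (1 / ε)) := by
  -- `K` bounds `|V - E|` for all energies `E` at which the spectral projection does not vanish
  set K : ℝ := 2 * |Vinf| + |E₀| + 1 with hKdef
  have hK : 1 ≤ K := by linarith [abs_nonneg Vinf, abs_nonneg E₀]
  refine ⟨1, 4 * (K + 1), one_pos, by linarith, ?_⟩
  intro V hV ε hε hε2 a b hab hL
  refine ⟨exists_isSpectralMeasure_dirichletSchrodinger V hab, fun P hP E hE => ?_⟩
  have hVnn : 0 ≤ Vinf := hV ▸ norm_nonneg V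
  have hlog : 0 < Real.log (1 / ε) := Real.log_pos (by rw [lt_div_iff₀ hε]; linarith)
  rw [one_mul] at hL
  rcases lt_or_ge (E + ε) (-‖V‖) with hlow | hlow
  · rw [densityOfStates, proj_Icc_eq_zero_of_lt hab hP hlow]
    simp [traceNonneg]
  have hEK : ‖V‖ + |E| ≤ K := by
    have h1 : |E| ≤ Vinf + |E₀| + 1 := by
      rw [abs_le]
      constructor
      · rw [hV] at hlow; linarith [abs_nonneg E₀]
      · linarith [le_abs_self E₀]
    rw [hV, hKdef, abs_of_nonneg hVnn]
    linarith
  -- `R` is chosen so that cells of length `δ ≤ R` satisfy `δ exp (K δ) < exp ((K + 1) R) = 1 / ε`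
  set R : ℝ := Real.log (1 / ε) / (K + 1) with hR
  have hR0 : 0 < R := by positivity
  have hRL : R ≤ b - a := by
    refine le_trans ?_ hL
    exact div_le_self hlog.le (by linarith)
  have hba : 0 < b - a := sub_pos.mpr hab
  set n : ℕ := ⌈(b - a) / R⌉₊ with hn
  have hn0 : 0 < n := Nat.ceil_pos.mpr (by positivity)
  have hn0' : (0 : ℝ) < n := by exact_mod_cast hn0
  set δ : ℝ := (b - a) / n with hδ
  have hδ0 : 0 < δ := by positivity
  have hδR : δ ≤ R := by
    rw [hδ, div_le_iff₀ hn0', ← div_le_iff₀' hR0]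
    exact Nat.le_ceil _
  have hsmall : δ * Real.exp (K * δ) * ε < 1 := by
    have h1 : δ < Real.exp δ := by linarith [Real.add_one_le_exp δ]
    have h2 : Real.exp δ * Real.exp (K * δ) ≤ 1 / ε := by
      rw [← Real.exp_add, ← Real.le_log_iff_exp_le (by positivity)]
      calc δ + K * δ = δ * (K + 1) := by ring
        _ ≤ R * (K + 1) := by gcongr
        _ = Real.log (1 / ε) := by rw [hR]; field_simp
    have h3 : δ * Real.exp (K * δ) < 1 / ε :=
      (mul_lt_mul_of_pos_right h1 (Real.exp_pos _)).trans_le h2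
    rwa [lt_div_iff₀ hε] at h3
  have htr := traceNonneg_proj_Icc_le hP hε.le hK hEK hδ0.le (by rw [hδ]; field_simp; ring) hsmall
  have hcount : ((n * 2 : ℕ) : ℝ) ≤ 4 * (K + 1) / Real.log (1 / ε) * (b - a) := by
    have h1 : (n : ℝ) < (b - a) / R + 1 := Nat.ceil_lt_add_one (by positivity)
    have h2 : 1 ≤ (b - a) / R := (one_le_div hR0).mpr hRL
    have h3 : 4 * (K + 1) / Real.log (1 / ε) * (b - a) = 4 * ((b - a) / R) := by
      rw [hR]; field_simp
    rw [h3]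
    push_cast
    linarith
  rw [densityOfStates, Real.volume_Ioo]
  refine ENNReal.div_le_of_le_mul (htr.trans ?_)
  rw [← ENNReal.ofReal_mul (by positivity), ← ENNReal.ofReal_natCast]
  exact ENNReal.ofReal_le_ofReal hcount
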